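/- Let $U$ be an infinite-dimensional separable real Hilbert space, $Y$ a real Hilbert space, and $Q$ a bounded self-adjoint strictly positive operator on $U$ (i.e. $Q\ge 0$ and $Qx\neq 0$ for $x\ne 0$). For a bounded non-negative self-adjoint operator $R$ on a Hilbert space $V$, regard $R^{1/2}(V)$ as a Hilbert space with the norm $\|R^{-1/2}u\|_V$, where $R^{-1/2}u$ is the preimage of $u$ under $R^{1/2}$ that is orthogonal to $\ker R^{1/2}$. Put $U_0=Q^{1/2}(U)$, and let $(g_j)_{j\ge1}$ be an orthonormal basis of $U_0$. Let $(\Omega,\mathcal F,(\mathcal F_t)_{t\ge0},P)$ be a filtered probability space and $(\beta_j)_{j\ge1}$ a family of independent standard real Wiener processes, each of them a Wiener process with respect to $(\mathcal F_t)$ (adapted, with $\beta_j(t)-\beta_j(s)$ independent of $\mathcal F_s$ for $s\le t$). Let $T\ge0$. For a Hilbert space $H$, write $L_2(H,Y)$ for the Hilbert–Schmidt operators from $H$ to $Y$, and let $N_H(Y)$ be the set of all $\Phi:[0,T]\times\Omega\to L_2(H,Y)$ such that for every $u\in H$ the $Y$-valued process $\Phi(t)u$ is (jointly) measurable and adapted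 to $(\mathcal F_t)$, and $$E\int_0^T\|\Phi(t)\|_{L_2(H,Y)}^2\,dt<\infty .$$ The Itô integral $\int_0^t\varphi\,d\beta_j$ of a $Y$-valued process $\varphi$ is the limit in $L^2(\Omega;Y)$ of the integrals of simple adapted processes that converge to $\varphi$ in $L^2([0,t]\times\Omega;Y)$. 1. Let $\Phi\in N_{U_0}(Y)$ and $t\in[0,T]$. Then each Itô integral $\int_0^t\Phi(s)g_j\,d\beta_j(s)$ exists and is almost surely unique; the partial sums $\sum_{j=1}^m\int_0^t\Phi(s)g_j\,d\beta_j(s)$ form a Cauchy sequence in $L^2(\Omega;Y)$; and hence the integral $$\int_0^t\Phi(s)\,dW_c(s)=\lim_{m\to\infty}\sum_{j=1}^m\int_0^t\Phi(s)g_j\,d\beta_j(s)\quad\text{in }L^2(\Omega;Y)$$ exists and is almost surely unique. 2. The class of integrands and the integral do not depend on the auxiliary space: let $U_1$ be any real Hilbert space and $J:U\to U_1$ a continuous linear injection whose restriction to $U_0$ is a Hilbert–Schmidt operator $U_0\to U_1$. Then for every $t\ge0$ the series $W_c(t)=\sum_j\beta_j(t)Jg_j$ converges in $L^2(\Omega;U_1)$.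 If $Q_1$ is the covariance operator of $W_c(1)$ in $U_1$, then $J$ restricts to an isometric isomorphism $e$ of $U_0$ onto $Q_1^{1/2}(U_1)$. A process $\Phi$ with values in the bounded operators from $U_0$ to $Y$ belongs to $N_{U_0}(Y)$ if and only if $\Phi e^{-1}$ belongs to $N_{Q_1^{1/2}(U_1)}(Y)$, and for every $t\in[0,T]$ a random variable is the integral of $\Phi$ over $[0,t]$ formed with $U_0$ and $(g_j)$ if and only if it is the integral of $\Phi e^{-1}$ formed with $Q_1^{1/2}(U_1)$ and its orthonormal basis $(e g_j)$. -/

import Mathlib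

open MeasureTheory ProbabilityTheory Filter Topology
open scoped NNReal ENNReal InnerProductSpace

noncomputable section

namespace CylindricalWiener

/-! ### The positive square root and the space `Q^{1/2}(V)` -/

section RootSpace

variable {V : Type*} [NormedAddCommGroup V] [InnerProductSpace ℝ V]

/-- The positive square root `Q^{1/2}` of a positive bounded operator `Q`: the unique positive
bounded operator whose square is `Q`. -/
def opSqrt (Q : V →L[ℝ] V) : V →L[ℝ] V :=
  Classical.epsilon fun R : V →L[ℝ] V => R.IsPositive ∧ R ∘L R = Q

/-- The linear space `Q^{1/2}(V)`, the range of the square root of `Q`. -/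
def RootSpace (Q : V →L[ℝ] V) : Type _ :=
  ↥(LinearMap.range (opSqrt Q : V →ₗ[ℝ] V))

namespace RootSpace

variable (Q : V →L[ℝ] V)

instance : AddCommGroup (RootSpace Q) :=
  inferInstanceAs (AddCommGroup ↥(LinearMap.range (opSqrt Q : V →ₗ[ℝ] V)))

instance : Module ℝ (RootSpace Q) :=
  inferInstanceAs (Module ℝ ↥(LinearMap.range (opSqrt Q : V →ₗ[ℝ] V)))

/-- The inclusion of `Q^{1/2}(V)` in `V`, as a linear map. -/
def val : RootSpace Q →ₗ[ℝ] V :=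
  (LinearMap.range (opSqrt Q : V →ₗ[ℝ] V)).subtype

variable [CompleteSpace V]

instance completeSpace_ker :
    CompleteSpace (LinearMap.ker (opSqrt Q : V →ₗ[ℝ] V)) :=
  (ContinuousLinearMap.isClosed_ker (opSqrt Q)).completeSpace_coe

/-- `Q^{-1/2}`, as a linear bijection of `Q^{1/2}(V)` onto the orthogonal complement of
`ker Q^{1/2}`; this complement is all of `V` when `Q` is strictly positive. -/
def invSqrt :
    RootSpace Q ≃ₗ[ℝ] ↥(LinearMap.ker (opSqrt Q : V →ₗ[ℝ] V))ᗮ :=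
  ((opSqrt Q : V →ₗ[ℝ] V).quotKerEquivRange).symm.trans
    (Submodule.quotientEquivOfIsCompl _ _
      (Submodule.isCompl_orthogonal
        (K := LinearMap.ker (opSqrt Q : V →ₗ[ℝ] V))))

theorem opSqrt_invSqrt (u : RootSpace Q) : opSqrt Q (invSqrt Q u : V) = val Q u := by
  obtain ⟨y, rfl⟩ := (invSqrt Q).symm.surjective u
  rw [LinearEquiv.apply_symm_apply]
  rfl

/-- The norm `‖u‖ = ‖Q^{-1/2} u‖_V` of `Q^{1/2}(V)`. -/
instance : NormedAddCommGroup (RootSpace Q) :=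
  NormedAddCommGroup.induced (RootSpace Q) _ (invSqrt Q) (invSqrt Q).injective

theorem norm_def (u : RootSpace Q) : ‖u‖ = ‖(invSqrt Q u : V)‖ := rfl

instance : InnerProductSpace ℝ (RootSpace Q) where
  inner u v := ⟪(invSqrt Q u : V), (invSqrt Q v : V)⟫_ℝ
  norm_smul_le c u := by simp [norm_def, norm_smul]
  norm_sq_eq_re_inner u := by simp [norm_def]
  conj_inner_symm u v := by simp [real_inner_comm]
  add_left u v w := by simp [inner_add_left]
  smul_left u v c := by simp [inner_smul_left]

instance : CompleteSpace (RootSpace Q) := by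
  let e : RootSpace Q ≃ₗᵢ[ℝ] ↥(LinearMap.ker (opSqrt Q : V →ₗ[ℝ] V))ᗮ := ⟨invSqrt Q, fun _ => rfl⟩
  exact e.toIsometryEquiv.completeSpace

/-- The inclusion of `Q^{1/2}(V)` in `V`, as a bounded operator. -/
def incl : RootSpace Q →L[ℝ] V :=
  (val Q).mkContinuous ‖opSqrt Q‖ fun u => by
    rw [← opSqrt_invSqrt, norm_def]
    exact (opSqrt Q).le_opNorm _

theorem incl_apply (u : RootSpace Q) : incl Q u = val Q u := rfl

end RootSpace

end RootSpace

/-! ### Hilbert-Schmidt operators -/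

section HilbertSchmidt

variable {H Y : Type*} [NormedAddCommGroup H] [InnerProductSpace ℝ H] [CompleteSpace H]
  [NormedAddCommGroup Y] [InnerProductSpace ℝ Y]

/-- The squared Hilbert-Schmidt norm `∑ₖ ‖T eₖ‖²`, for an orthonormal basis `(eₖ)` of `H`. It does
not depend on the basis, see `hsNormSq_eq_tsum`. -/
def hsNormSq (T : H →L[ℝ] Y) : ℝ≥0∞ :=
  ∑' x : (exists_hilbertBasis ℝ H).choose, ‖T (x : H)‖ₑ ^ 2

/-- `T` is a Hilbert-Schmidt operator. -/
def IsHilbertSchmidt (T : H →L[ℝ] Y) : Prop := hsNormSq T < ∞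

theorem tsum_enorm_inner_sq {E ι : Type*} [NormedAddCommGroup E] [InnerProductSpace ℝ E]
    (b : HilbertBasis ι ℝ E) (x : E) : ∑' i, ‖⟪b i, x⟫_ℝ‖ₑ ^ 2 = ‖x‖ₑ ^ 2 := by
  have h := b.hasSum_inner_mul_inner x x
  have h2 : ∀ i, ⟪x, b i⟫_ℝ * ⟪b i, x⟫_ℝ = ‖⟪b i, x⟫_ℝ‖ ^ 2 := fun i => by
    rw [real_inner_comm, ← sq, Real.norm_eq_abs, sq_abs]
  simp_rw [h2, real_inner_self_eq_norm_sq] at h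
  have h3 := ENNReal.ofReal_tsum_of_nonneg (fun i => sq_nonneg ‖⟪b i, x⟫_ℝ‖) h.summable
  rw [h.tsum_eq] at h3
  simp_rw [ENNReal.ofReal_pow (norm_nonneg _), ofReal_norm] at h3
  exact h3.symm

theorem tsum_enorm_apply_sq [CompleteSpace Y] {ι κ : Type*} (b : HilbertBasis ι ℝ H)
    (f : HilbertBasis κ ℝ Y) (T : H →L[ℝ] Y) :
    ∑' i, ‖T (b i)‖ₑ ^ 2 = ∑' j, ‖T.adjoint (f j)‖ₑ ^ 2 := by
  have h : ∀ i j, ⟪b i, T.adjoint (f j)⟫_ℝ = ⟪f j, T (b i)⟫_ℝ := fun i j => by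
    rw [ContinuousLinearMap.adjoint_inner_right, real_inner_comm]
  simp_rw [← tsum_enorm_inner_sq f, ← tsum_enorm_inner_sq b, h]
  exact ENNReal.tsum_comm

theorem hsNormSq_eq_tsum [CompleteSpace Y] {ι : Type*} (b : HilbertBasis ι ℝ H)
    (T : H →L[ℝ] Y) : hsNormSq T = ∑' i, ‖T (b i)‖ₑ ^ 2 := by
  obtain ⟨w, f, -⟩ := exists_hilbertBasis ℝ Y
  obtain ⟨e, he⟩ := (exists_hilbertBasis ℝ H).choose_spec
  rw [tsum_enorm_apply_sq b f, ← tsum_enorm_apply_sq e f, he]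
  rfl

end HilbertSchmidt

/-! ### Real Wiener processes and the Itô integral of Hilbert space valued processes -/

section Ito

variable {Ω : Type*} {mΩ : MeasurableSpace Ω}

/-- Lebesgue measure on the time axis `[0, ∞)`. -/
def timeMeasure : Measure ℝ≥0 := Measure.comap (fun t : ℝ≥0 => (t : ℝ)) volume

/-- A standard real Wiener process with respect to the filtration `ℱ`: a Brownian motion that is
adapted and whose increments after time `s` are independent of `ℱ s`. -/
structure IsWiener (ℱ : Filtration ℝ≥0 mΩ) (P : Measure Ω) (β : ℝ≥0 → Ω → ℝ) : Prop where
  isBrownian : IsBrownianReal β P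
  adapted : StronglyAdapted ℱ β
  indep_increment : ∀ s t : ℝ≥0, s ≤ t →
    Indep (MeasurableSpace.comap (fun ω => β t ω - β s ω) inferInstance) (ℱ s) P

variable {Y : Type*} [NormedAddCommGroup Y] [InnerProductSpace ℝ Y]

/-- A simple adapted process `∑ₖ 1_{(tₖ, tₖ₊₁]}(s) ξₖ`, with `t₀ ≤ t₁ ≤ … ≤ tₙ` and `ξₖ`
square integrable and `ℱ_{tₖ}`-measurable. -/
structure SimpleProcess (ℱ : Filtration ℝ≥0 mΩ) (P : Measure Ω) (Y : Type*)
    [NormedAddCommGroup Y] where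
  n : ℕ
  time : Fin (n + 1) → ℝ≥0
  mono : Monotone time
  coeff : Fin n → Ω → Y
  measurable_coeff : ∀ k, StronglyMeasurable[ℱ (time k.castSucc)] (coeff k)
  memLp_coeff : ∀ k, MemLp (coeff k) 2 P

namespace SimpleProcess

variable {ℱ : Filtration ℝ≥0 mΩ} {P : Measure Ω}

/-- The value of a simple process at time `s`. -/
def eval (S : SimpleProcess ℱ P Y) (s : ℝ≥0) (ω : Ω) : Y :=
  ∑ k : Fin S.n,
    (Set.Ioc (S.time k.castSucc) (S.time k.succ)).indicator (fun _ => S.coeff k ω) s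

/-- The stochastic integral `∫₀ᵗ S dβ = ∑ₖ (β(tₖ₊₁ ∧ t) - β(tₖ ∧ t)) ξₖ` of a simple process. -/
def integral (S : SimpleProcess ℱ P Y) (β : ℝ≥0 → Ω → ℝ) (t : ℝ≥0) (ω : Ω) : Y :=
  ∑ k : Fin S.n,
    (β (min (S.time k.succ) t) ω - β (min (S.time k.castSucc) t) ω) • S.coeff k ω

end SimpleProcess

/-- `Z` is (a version of) the Itô integral `∫₀ᵗ φ dβ`: it is the `L²(Ω; Y)` limit of the integrals
of simple adapted processes that converge to `φ` in `L²([0, t] × Ω; Y)`. -/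
def IsItoIntegral (ℱ : Filtration ℝ≥0 mΩ) (P : Measure Ω) (β : ℝ≥0 → Ω → ℝ)
    (φ : ℝ≥0 → Ω → Y) (t : ℝ≥0) (Z : Ω → Y) : Prop :=
  MemLp Z 2 P ∧ ∃ S : ℕ → SimpleProcess ℱ P Y,
    Tendsto (fun n => ∫⁻ ω, (∫⁻ s in Set.Icc 0 t, ‖(S n).eval s ω - φ s ω‖ₑ ^ 2 ∂timeMeasure) ∂P) atTop (𝓝 0) ∧
    Tendsto (fun n => eLpNorm (fun ω => (S n).integral β t ω - Z ω) 2 P) atTop (𝓝 0)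

/-! ### The cylindrical Wiener process and the integral with respect to it -/

variable {H : Type*} [NormedAddCommGroup H] [InnerProductSpace ℝ H]

/-- The class `N(Y)` of integrands on `[0, T]`: processes with values in the Hilbert-Schmidt
operators `L₂(H, Y)` such that `E ∫₀ᵀ ‖Φ(t)‖²_{HS} dt < ∞` and such that, for every `u ∈ H`, the
`Y`-valued process `Φ(t) u` is measurable and adapted. -/
structure IsIntegrand [CompleteSpace H] (ℱ : Filtration ℝ≥0 mΩ) (P : Measure Ω) (T : ℝ≥0)
    (Φ : ℝ≥0 → Ω → H →L[ℝ] Y) : Prop where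
  isHilbertSchmidt : ∀ t ≤ T, ∀ ω, IsHilbertSchmidt (Φ t ω)
  measurable : ∀ u : H, StronglyMeasurable fun p : Set.Icc (0 : ℝ≥0) T × Ω => Φ p.1 p.2 u
  adapted : ∀ u : H, ∀ t ≤ T, StronglyMeasurable[ℱ t] fun ω => Φ t ω u
  sq_integrable : ∫⁻ ω, (∫⁻ t in Set.Icc 0 T, hsNormSq (Φ t ω) ∂timeMeasure) ∂P < ∞

/-- `X j` is, for every `j`, a version of the Itô integral `∫₀ᵗ Φ(s) gⱼ dβⱼ(s)`. -/
def AreTermIntegrals (ℱ : Filtration ℝ≥0 mΩ) (P : Measure Ω) (g : ℕ → H)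
    (β : ℕ → ℝ≥0 → Ω → ℝ) (Φ : ℝ≥0 → Ω → H →L[ℝ] Y) (t : ℝ≥0) (X : ℕ → Ω → Y) : Prop :=
  ∀ j, IsItoIntegral ℱ P (β j) (fun s ω => Φ s ω (g j)) t (X j)

/-- The partial sums `∑_{j < m} X j`. -/
def partialSum (X : ℕ → Ω → Y) (m : ℕ) (ω : Ω) : Y := ∑ j ∈ Finset.range m, X j ω

/-- `I` is (a version of) the integral `∫₀ᵗ Φ dW_c`: it is the limit in `L²(Ω; Y)` of
`∑_{j < m} ∫₀ᵗ Φ(s) gⱼ dβⱼ(s)` as `m → ∞`. -/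
def IsCylindricalIntegral (ℱ : Filtration ℝ≥0 mΩ) (P : Measure Ω) (g : ℕ → H)
    (β : ℕ → ℝ≥0 → Ω → ℝ) (Φ : ℝ≥0 → Ω → H →L[ℝ] Y) (t : ℝ≥0) (I : Ω → Y) : Prop :=
  MemLp I 2 P ∧ ∃ X : ℕ → Ω → Y, AreTermIntegrals ℱ P g β Φ t X ∧
    Tendsto (fun m => eLpNorm (fun ω => partialSum X m ω - I ω) 2 P) atTop (𝓝 0)

/-- `W` is the process `W_c(t) = ∑ⱼ βⱼ(t) J gⱼ` in `K`, where `J : H → K` is an embedding; the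
series converges in `L²(Ω; K)` for every `t`. -/
def IsCylindricalWiener {K : Type*} [NormedAddCommGroup K] [InnerProductSpace ℝ K]
    (P : Measure Ω) (J : H →L[ℝ] K) (g : ℕ → H) (β : ℕ → ℝ≥0 → Ω → ℝ)
    (W : ℝ≥0 → Ω → K) : Prop :=
  ∀ t, MemLp (W t) 2 P ∧
    Tendsto (fun m => eLpNorm (fun ω => (∑ j ∈ Finset.range m, β j t ω • J (g j)) - W t ω) 2 P)
      atTop (𝓝 0)

end Ito

end CylindricalWiener

end

open CylindricalWiener

/-! Well-definedness of the integral is orthogonality in `L²(Ω; Y)`. For a single Wiener process the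
Itô isometry on simple processes, together with their density among square integrable adapted
processes, gives existence and uniqueness of the Itô integral. For different `j` the Itô integrals
are orthogonal, and their squared norms are at most twice `E ∫ ‖Φ gⱼ‖²`. These bounds sum to at most
twice `E ∫ ‖Φ‖²_HS`, because the Hilbert-Schmidt norm may be computed in the basis `g`. Hence the
partial sums are Cauchy (`AreTermIntegrals.cauchySeq`).

Orthogonality needs care: the increments of each `βⱼ` are independent of `ℱ s`, and the `βⱼ` are
independent of each other, but joint independence of a pair of increments from `ℱ s` is not assumed.
That `E[Δβᵢ Δβⱼ | ℱ s] = 0` is obtained by subdivision: over a set of `ℱ s`, the product of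
increments over `(a, b]` integrates to the same value as the sum of the products over `n` equal
subintervals, and that sum has second moment `(b - a)² / n` (`IsWiener.hasCovariation_zero`).

Density has to cope with integrands that are merely measurable and adapted. Such a process is
sampled on a grid whose offset is chosen by averaging, and the error is controlled by continuity of
translations in `L²` (`exists_shift`, `exists_simpleProcess_le`).

For independence of the auxiliary space put `A = J ∘ incl`. The covariance of `W_c(1)` is `A A*`
(`covarianceOperator_eq`). For injective `A`, polar decomposition turns `A` into an isometry `e`
onto `(A A*)^{1/2}(U₁)` (`exists_isometry_rootSpace`). Hilbert-Schmidt norms are invariant under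
`e`, and `Φ e⁻¹ (e gⱼ) = Φ gⱼ`, so both integrals are limits of the same series. -/

noncomputable section

namespace CylindricalWiener

/-! ### Square roots of positive operators -/

section SquareRoot

open Polynomial

/-- The polynomials approximating `1 - √(1 - X)`. -/
def sqrtPoly : ℕ → ℝ[X]
  | 0 => 0
  | n + 1 => C (1 / 2) * (X + sqrtPoly n ^ 2)

theorem coeff_mul_nonneg {p q : ℝ[X]} (hp : ∀ i, 0 ≤ p.coeff i) (hq : ∀ i, 0 ≤ q.coeff i) (i : ℕ) :
    0 ≤ (p * q).coeff i := by
  rw [coeff_mul]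
  exact Finset.sum_nonneg fun x _ => mul_nonneg (hp _) (hq _)

theorem coeff_sqrtPoly_nonneg (n i : ℕ) : 0 ≤ (sqrtPoly n).coeff i := by
  induction n generalizing i with
  | zero => simp [sqrtPoly]
  | succ n ih =>
    rw [sqrtPoly, coeff_C_mul, coeff_add, coeff_X, sq]
    have := coeff_mul_nonneg ih ih i
    split_ifs <;> linarith

/-- The recursion gives `p_{n+2} - p_{n+1} = ½ (p_{n+1} - p_n)(p_{n+1} + p_n)`, so nonnegativity of
the coefficients propagates by induction. -/
theorem coeff_sqrtPoly_sub_nonneg (n i : ℕ) : 0 ≤ (sqrtPoly (n + 1) - sqrtPoly n).coeff i := by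
  induction n generalizing i with
  | zero => simpa [sqrtPoly] using coeff_sqrtPoly_nonneg 1 i
  | succ n ih =>
    have h : sqrtPoly (n + 1 + 1) - sqrtPoly (n + 1) =
        C (1 / 2) * ((sqrtPoly (n + 1) - sqrtPoly n) * (sqrtPoly (n + 1) + sqrtPoly n)) := by
      rw [sqrtPoly]
      conv_lhs => rw [sqrtPoly.eq_2 n]
      rw [sqrtPoly.eq_2 n]
      ring
    rw [h, coeff_C_mul]
    refine mul_nonneg (by norm_num) (coeff_mul_nonneg ih (fun j => ?_) i)
    rw [coeff_add]
    exact add_nonneg (coeff_sqrtPoly_nonneg _ _) (coeff_sqrtPoly_nonneg _ _)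

theorem coeff_sqrtPoly_sub_nonneg_of_le {m n : ℕ} (h : m ≤ n) (i : ℕ) :
    0 ≤ (sqrtPoly n - sqrtPoly m).coeff i := by
  induction n, h using Nat.le_induction with
  | base => simp
  | succ n _ ih =>
    have := coeff_sqrtPoly_sub_nonneg n i
    rw [coeff_sub] at *
    linarith

/-- The map `x ↦ (1 + x²) / 2` preserves `[0, 1]`. -/
theorem eval_one_sqrtPoly (n : ℕ) : 0 ≤ (sqrtPoly n).eval 1 ∧ (sqrtPoly n).eval 1 ≤ 1 := by
  induction n with
  | zero => simp [sqrtPoly]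
  | succ n ih =>
    simp only [sqrtPoly, eval_mul, eval_C, eval_add, eval_X, eval_pow]
    constructor <;> nlinarith

variable {V : Type*} [NormedAddCommGroup V] [InnerProductSpace ℝ V]

/-- With nonnegative coefficients and `‖Bⁱ‖ ≤ 1`, the triangle inequality reduces operator estimates
to the scalar value at `1`. -/
theorem norm_aeval_le {B : V →L[ℝ] V} (hB : ‖B‖ ≤ 1) {p : ℝ[X]} (hp : ∀ i, 0 ≤ p.coeff i) :
    ‖aeval B p‖ ≤ p.eval 1 := by
  rw [aeval_eq_sum_range, eval_eq_sum_range]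
  refine norm_sum_le_of_le _ fun i _ => ?_
  rw [norm_smul, Real.norm_of_nonneg (hp i), one_pow]
  refine mul_le_mul_of_nonneg_left ?_ (hp i)
  clear * - hB
  induction i with
  | zero => exact ContinuousLinearMap.norm_id_le (𝕜 := ℝ) (E := V)
  | succ i ih =>
    rw [pow_succ]
    exact (norm_mul_le _ _).trans (mul_le_one₀ ih (norm_nonneg _) hB)

theorem isSelfAdjoint_aeval [CompleteSpace V] {B : V →L[ℝ] V} (hB : IsSelfAdjoint B) (p : ℝ[X]) :
    IsSelfAdjoint (aeval B p) := by
  rw [aeval_eq_sum_range]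
  exact isSelfAdjoint_sum _ fun i _ => (IsSelfAdjoint.all (p.coeff i)).smul (hB.pow i)

/-- `Y` is the limit of `Y_{n+1} = ½ (B + Y_n²)`. Differences of iterates are dominated by those of
the bounded monotone real sequence `p_n(1)`, so the iterates are Cauchy, and the fixed point
equation `2Y = B + Y²` is the claim. -/
theorem exists_one_sub_sq [CompleteSpace V] {B : V →L[ℝ] V} (hB : ‖B‖ ≤ 1)
    (hBs : IsSelfAdjoint B) :
    ∃ Y : V →L[ℝ] V, ‖Y‖ ≤ 1 ∧ IsSelfAdjoint Y ∧ (1 - Y) * (1 - Y) = 1 - B := by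
  set y : ℕ → V →L[ℝ] V := fun n => aeval B (sqrtPoly n) with hy
  set a : ℕ → ℝ := fun n => (sqrtPoly n).eval 1 with ha
  have hle : ∀ m n, m ≤ n → ‖y n - y m‖ ≤ a n - a m := fun m n h => by
    have := norm_aeval_le hB (coeff_sqrtPoly_sub_nonneg_of_le h)
    simpa using this
  have hmono : Monotone a := fun m n h => by
    have := (norm_nonneg _).trans (hle m n h)
    linarith
  have hac : CauchySeq a :=
    (tendsto_atTop_ciSup hmono ⟨1, by rintro _ ⟨n, rfl⟩; exact (eval_one_sqrtPoly n).2⟩).cauchySeq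
  have hyc : CauchySeq y := by
    rw [Metric.cauchySeq_iff'] at hac ⊢
    intro ε hε
    obtain ⟨N, hN⟩ := hac ε hε
    refine ⟨N, fun n hn => lt_of_le_of_lt ?_ (hN n hn)⟩
    rw [dist_eq_norm, Real.dist_eq]
    exact (hle N n hn).trans (le_abs_self _)
  obtain ⟨Y, hY⟩ := cauchySeq_tendsto_of_complete hyc
  refine ⟨Y, ?_, ?_, ?_⟩
  · exact le_of_tendsto hY.norm (Eventually.of_forall fun n =>
      (norm_aeval_le hB (coeff_sqrtPoly_nonneg n)).trans (eval_one_sqrtPoly n).2)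
  · exact (isClosed_eq continuous_star continuous_id).mem_of_tendsto hY
      (Eventually.of_forall fun n => isSelfAdjoint_aeval hBs _)
  · have h1 : Tendsto (fun n => y (n + 1)) atTop (𝓝 Y) := hY.comp (tendsto_add_atTop_nat 1)
    have h2 : Tendsto (fun n => y (n + 1)) atTop (𝓝 ((1 / 2 : ℝ) • (B + Y * Y))) := by
      have : ∀ n, y (n + 1) = (1 / 2 : ℝ) • (B + y n * y n) := fun n => by
        simp only [hy, sqrtPoly, map_mul, aeval_C, map_add, aeval_X, sq, Algebra.smul_def]
      simp_rw [this]
      exact (tendsto_const_nhds.add (hY.mul hY)).const_smul _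
    have h3 := tendsto_nhds_unique h1 h2
    have h4 : Y + Y = B + Y * Y := by
      have : (2 : ℝ) • Y = B + Y * Y := by
        conv_lhs => rw [h3]
        rw [smul_smul]; norm_num
      rw [← this, two_smul]
    calc (1 - Y) * (1 - Y) = 1 - (Y + Y) + Y * Y := by noncomm_ring
      _ = 1 - B := by rw [h4]; abel

variable {H : Type*} [NormedAddCommGroup H] [InnerProductSpace ℝ H] [CompleteSpace H]
  [CompleteSpace V]

-- Take `B = 1 - C` with `C = A A*`. Then `‖x - Cx‖² = ‖x‖² - 2‖A*x‖² + ‖Cx‖²` and `‖Cx‖ ≤ ‖A*x‖`,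
-- so `‖B‖ ≤ 1`. The root `1 - Y` is positive because `‖Y‖ ≤ 1`.
open ContinuousLinearMap in
theorem exists_isPositive_sq_of_norm_le_one {A : H →L[ℝ] V} (hA : ‖A‖ ≤ 1) :
    ∃ R : V →L[ℝ] V, R.IsPositive ∧ R ∘L R = A ∘L A.adjoint := by
  set C := A ∘L A.adjoint with hC
  have hCs : IsSelfAdjoint C := (isPositive_self_comp_adjoint A).isSelfAdjoint
  have hB : ‖1 - C‖ ≤ 1 := by
    refine opNorm_le_bound _ zero_le_one fun x => ?_
    rw [one_mul, ← sq_le_sq₀ (norm_nonneg _) (norm_nonneg _), sub_apply, show (1 : V →L[ℝ] V) x = x from rfl,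
      norm_sub_sq_real]
    have h1 : ⟪x, C x⟫_ℝ = ‖A.adjoint x‖ ^ 2 := by
      rw [hC, comp_apply, ← adjoint_inner_left, real_inner_self_eq_norm_sq]
    have h2 : ‖C x‖ ≤ ‖A.adjoint x‖ := by
      refine (A.le_opNorm _).trans ?_
      exact mul_le_of_le_one_left (norm_nonneg _) hA
    have h3 : ‖C x‖ ^ 2 ≤ ‖A.adjoint x‖ ^ 2 := by gcongr
    nlinarith [sq_nonneg ‖A.adjoint x‖]
  obtain ⟨Y, hY, hYs, h⟩ := exists_one_sub_sq hB (IsSelfAdjoint.one (V →L[ℝ] V) |>.sub hCs)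
  refine ⟨1 - Y, ?_, h.trans (sub_sub_cancel _ _)⟩
  rw [isPositive_iff']
  refine ⟨IsSelfAdjoint.one (V →L[ℝ] V) |>.sub hYs, fun x => ?_⟩
  rw [sub_apply, show (1 : V →L[ℝ] V) x = x from rfl, inner_sub_left, real_inner_self_eq_norm_sq, sub_nonneg]
  calc ⟪Y x, x⟫_ℝ ≤ ‖Y x‖ * ‖x‖ := real_inner_le_norm _ _
    _ ≤ ‖x‖ * ‖x‖ := by
      gcongr
      exact (Y.le_opNorm x).trans (mul_le_of_le_one_left (norm_nonneg _) hY)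
    _ = ‖x‖ ^ 2 := (sq _).symm

theorem exists_isPositive_sq (A : H →L[ℝ] V) :
    ∃ R : V →L[ℝ] V, R.IsPositive ∧ R ∘L R = A ∘L A.adjoint := by
  -- The added `1` keeps the scaling factor nonzero when `A = 0`.
  have hc : 0 < ‖A‖ + 1 := by positivity
  have hA : ‖(‖A‖ + 1)⁻¹ • A‖ ≤ 1 := by
    rw [norm_smul, Real.norm_of_nonneg (by positivity), inv_mul_le_one₀ hc]
    linarith
  obtain ⟨R, hR, h⟩ := exists_isPositive_sq_of_norm_le_one hA
  refine ⟨(‖A‖ + 1) • R, hR.smul_of_nonneg hc.le, ?_⟩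
  rw [ContinuousLinearMap.smul_comp, ContinuousLinearMap.comp_smul, h]
  ext x
  simp [smul_smul]
  field_simp
  rw [one_smul]

/-- `opSqrt` is an epsilon choice, so its two defining properties become available only once some
positive root has been exhibited. -/
theorem opSqrt_self_comp_adjoint (A : H →L[ℝ] V) :
    (opSqrt (A ∘L A.adjoint)).IsPositive ∧
      opSqrt (A ∘L A.adjoint) ∘L opSqrt (A ∘L A.adjoint) = A ∘L A.adjoint :=
  Classical.epsilon_spec (exists_isPositive_sq A)

/-- If `A` is injective, then `A` is an isometry of `H` onto `(A A*)^{1/2}(V)`. -/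
theorem exists_isometry_rootSpace {A : H →L[ℝ] V} (hA : Function.Injective A) {C : V →L[ℝ] V}
    (hC : C = A ∘L A.adjoint) :
    ∃ e : H ≃ₗᵢ[ℝ] RootSpace C, ∀ u, RootSpace.incl C (e u) = A u := by
  obtain ⟨hpos, hsq⟩ := opSqrt_self_comp_adjoint A
  rw [← hC] at hpos hsq
  set R := opSqrt C with hR
  set K := LinearMap.ker (R : V →ₗ[ℝ] V) with hK
  have hRs : ∀ x y, ⟪R x, y⟫_ℝ = ⟪x, R y⟫_ℝ := hpos.inner_left_eq_inner_right
  have hRK : ∀ x, R x ∈ Kᗮ := fun x k hk => by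
    rw [← hRs, show R k = 0 from hk, inner_zero_left]
  let S : V →ₗ[ℝ] Kᗮ := (R : V →ₗ[ℝ] V).codRestrict Kᗮ hRK
  -- Since `R² = A A*`, the correspondence `A* x ↦ R x` is isometric. It is densely defined because
  -- `A` is injective, and has dense range in `Kᗮ`; its extension is the unitary factor of the polar
  -- decomposition.
  have hnorm : ∀ x, ‖S x‖ = ‖(A.adjoint : V →ₗ[ℝ] H) x‖ := fun x => by
    have h1 : ‖R x‖ ^ 2 = ‖A.adjoint x‖ ^ 2 := by
      rw [← real_inner_self_eq_norm_sq, ← real_inner_self_eq_norm_sq, hRs,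
        ContinuousLinearMap.adjoint_inner_left, ← ContinuousLinearMap.comp_apply, hsq, hC]
      rfl
    exact (sq_eq_sq₀ (norm_nonneg _) (norm_nonneg _)).1 h1
  have hd1 : DenseRange (A.adjoint : V →ₗ[ℝ] H) := by
    have : (LinearMap.range (A.adjoint : V →ₗ[ℝ] H)).topologicalClosure = ⊤ := by
      rw [Submodule.topologicalClosure_eq_top_iff, Submodule.eq_bot_iff]
      intro u hu
      apply hA
      rw [map_zero, ← inner_self_eq_zero (𝕜 := ℝ), ← ContinuousLinearMap.adjoint_inner_left]
      exact hu _ ⟨_, rfl⟩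
    exact Submodule.dense_iff_topologicalClosure_eq_top.2 this
  have hd2 : DenseRange S := by
    have : (LinearMap.range S).topologicalClosure = ⊤ := by
      rw [Submodule.topologicalClosure_eq_top_iff, Submodule.eq_bot_iff]
      intro u hu
      have h0 : R u = 0 := by
        rw [← inner_self_eq_zero (𝕜 := ℝ), ← hRs]
        exact hu (S (R u)) ⟨_, rfl⟩
      have : (u : V) ∈ K := h0
      exact Subtype.ext (inner_self_eq_zero (𝕜 := ℝ).1 (u.2 _ this))
    exact Submodule.dense_iff_topologicalClosure_eq_top.2 this
  let v : H ≃ₗᵢ[ℝ] Kᗮ := LinearEquiv.extendOfIsometry (LinearEquiv.refl ℝ V)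
    (A.adjoint : V →ₗ[ℝ] H) S hd1 hd2 hnorm
  have hv : ∀ x, v ((A.adjoint : V →ₗ[ℝ] H) x) = S x := fun x =>
    LinearEquiv.extendOfIsometry_eq ..
  -- On the dense range of `A*` this reads `R R x = A A* x`.
  have hRv : ∀ u, R (v u) = A u := by
    intro u
    refine congrFun (DenseRange.equalizer (g := fun u => R (v u)) (h := A) hd1 (by fun_prop) (by fun_prop) ?_) u
    ext x
    change R (v ((A.adjoint : V →ₗ[ℝ] H) x)) = A ((A.adjoint : V →ₗ[ℝ] H) x)
    rw [hv]
    change (R ∘L R) x = _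
    rw [hsq, hC]
    rfl
  let w : RootSpace C ≃ₗᵢ[ℝ] Kᗮ := ⟨RootSpace.invSqrt C, fun _ => rfl⟩
  refine ⟨v.trans w.symm, fun u => ?_⟩
  rw [RootSpace.incl_apply, ← RootSpace.opSqrt_invSqrt, ← hRv]
  change R (w (w.symm (v u))) = _
  rw [LinearIsometryEquiv.apply_symm_apply]

end SquareRoot

/-! ### Approximation by simple processes -/

section Approximation

variable {Y : Type*} [NormedAddCommGroup Y]

theorem eLpNorm_two_sq {α : Type*} {m : MeasurableSpace α} {μ : Measure α} (f : α → Y) :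
    eLpNorm f 2 μ ^ 2 = ∫⁻ x, ‖f x‖ₑ ^ 2 ∂μ := by
  have := eLpNorm_nnreal_pow_eq_lintegral (μ := μ) (f := f) (p := 2) two_ne_zero
  simpa using this

theorem memLp_two_iff {α : Type*} {m : MeasurableSpace α} {μ : Measure α} {f : α → Y}
    (hf : AEStronglyMeasurable f μ) : MemLp f 2 μ ↔ ∫⁻ x, ‖f x‖ₑ ^ 2 ∂μ < ∞ := by
  rw [← eLpNorm_two_sq, ENNReal.pow_lt_top_iff]
  simp [MemLp, hf]

theorem enorm_sub_sq_le (a b : Y) : ‖a - b‖ₑ ^ 2 ≤ 2 * (‖a‖ₑ ^ 2 + ‖b‖ₑ ^ 2) := by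
  calc ‖a - b‖ₑ ^ 2 ≤ (‖a‖ₑ + ‖b‖ₑ) ^ 2 := by gcongr; exact enorm_sub_le
    _ ≤ 2 * (‖a‖ₑ ^ 2 + ‖b‖ₑ ^ 2) := by
      have := ENNReal.rpow_add_le_mul_rpow_add_rpow ‖a‖ₑ ‖b‖ₑ (p := 2) (by norm_num)
      norm_num at this
      exact this

/-- Continuity of translations in `L²(ℝ; Y)`. -/
theorem tendsto_lintegral_translate_sub {f : ℝ → Y} (hf : MemLp f 2 volume) :
    Tendsto (fun h => ∫⁻ x, ‖f (x + h) - f x‖ₑ ^ 2) (𝓝 0) (𝓝 0) := by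
  let τ : ℝ → C(ℝ, ℝ) := fun h => ⟨fun x => x + h, by fun_prop⟩
  have hτ : Tendsto τ (𝓝 0) (𝓝 (τ 0)) := by
    have : Continuous τ := by
      refine ContinuousMap.continuous_of_continuous_uncurry _ ?_
      change Continuous fun p : ℝ × ℝ => p.2 + p.1
      fun_prop
    exact this.tendsto 0
  have hm : ∀ h, MeasurePreserving (τ h) (volume : Measure ℝ) volume :=
    fun h => measurePreserving_add_right _ h
  have h1 := Filter.Tendsto.compMeasurePreservingLp (p := 2)
    (tendsto_const_nhds (x := hf.toLp f)) hτ hm (hm 0) (by norm_num)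
  rw [tendsto_iff_edist_tendsto_0] at h1
  have h2 : ∀ h, edist (Lp.compMeasurePreserving (τ h) (hm h) (hf.toLp f))
      (Lp.compMeasurePreserving (τ 0) (hm 0) (hf.toLp f)) ^ 2 =
      ∫⁻ x, ‖f (x + h) - f x‖ₑ ^ 2 := by
    intro h
    rw [Lp.toLp_compMeasurePreserving hf (hm h), Lp.toLp_compMeasurePreserving hf (hm 0),
      Lp.edist_toLp_toLp, eLpNorm_two_sq]
    simp [τ]
  simp_rw [← h2]
  simpa using ENNReal.Tendsto.pow (n := 2) h1

variable {Ω : Type*} {mΩ : MeasurableSpace Ω} {P : Measure Ω}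

/-- Continuity of time translations in `L²(Ω × ℝ; Y)`. -/
theorem tendsto_lintegral_lintegral_translate_sub {ψ : ℝ → Ω → Y}
    (hψ : StronglyMeasurable fun p : ℝ × Ω => ψ p.1 p.2)
    (hfin : ∫⁻ ω, (∫⁻ x, ‖ψ x ω‖ₑ ^ 2) ∂P < ∞) :
    Tendsto (fun h => ∫⁻ ω, (∫⁻ x, ‖ψ (x + h) ω - ψ x ω‖ₑ ^ 2) ∂P) (𝓝 0) (𝓝 0) := by
  have hm : Measurable fun ω => ∫⁻ x, ‖ψ x ω‖ₑ ^ 2 :=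
    (hψ.enorm.pow_const 2).lintegral_prod_left
  have hshift : ∀ h, StronglyMeasurable fun p : ℝ × Ω => ψ (p.1 + h) p.2 - ψ p.1 p.2 := fun h =>
    (hψ.comp_measurable (g := fun p : ℝ × Ω => (p.1 + h, p.2)) (by fun_prop)).sub hψ
  rw [← lintegral_zero (μ := P)]
  -- The factor `4` comes from `‖a - b‖² ≤ 2(‖a‖² + ‖b‖²)` and translation invariance of Lebesgue
  -- measure.
  refine tendsto_lintegral_filter_of_dominated_convergence (fun ω => 4 * ∫⁻ x, ‖ψ x ω‖ₑ ^ 2)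
    (Eventually.of_forall fun h => ?_)
    (Eventually.of_forall fun h => Eventually.of_forall fun ω => ?_) ?_ ?_
  · exact Measurable.lintegral_prod_left (f := fun x ω => ‖ψ (x + h) ω - ψ x ω‖ₑ ^ 2)
      ((hshift h).enorm.pow_const 2)
  · have hω : Measurable fun x => ‖ψ x ω‖ₑ ^ 2 :=
      (hψ.enorm.pow_const 2).comp measurable_prodMk_right
    calc ∫⁻ x, ‖ψ (x + h) ω - ψ x ω‖ₑ ^ 2
        ≤ ∫⁻ x, 2 * (‖ψ (x + h) ω‖ₑ ^ 2 + ‖ψ x ω‖ₑ ^ 2) :=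
          lintegral_mono fun x => enorm_sub_sq_le _ _
      _ = 4 * ∫⁻ x, ‖ψ x ω‖ₑ ^ 2 := by
        rw [lintegral_const_mul' _ _ (by norm_num), lintegral_add_right _ hω,
          lintegral_add_right_eq_self (fun x => ‖ψ x ω‖ₑ ^ 2) h]
        ring
  · rw [lintegral_const_mul' _ _ (by norm_num)]
    exact ENNReal.mul_ne_top (by norm_num) hfin.ne
  · filter_upwards [ae_lt_top hm hfin.ne] with ω hω
    have hs : StronglyMeasurable fun x => ψ x ω := hψ.comp_measurable measurable_prodMk_right
    have hL : MemLp (fun x => ψ x ω) 2 volume := by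
      rw [memLp_two_iff hs.aestronglyMeasurable]
      exact hω
    have key := tendsto_lintegral_translate_sub hL
    beta_reduce at key
    exact key

theorem exists_mem_Ioc_of_mem_Ioc {τ : ℕ → ℝ} {N : ℕ} {x : ℝ} (hx : x ∈ Set.Ioc (τ 0) (τ N)) :
    ∃ k < N, x ∈ Set.Ioc (τ k) (τ (k + 1)) := by
  induction N with
  | zero => exact absurd hx.1 (not_lt.2 hx.2)
  | succ N ih =>
    by_cases h : x ≤ τ N
    · obtain ⟨k, hk, hxk⟩ := ih ⟨hx.1, h⟩
      exact ⟨k, by omega, hxk⟩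
    · exact ⟨N, by omega, not_le.1 h, hx.2⟩

/-- As `ρ` runs over `(0, δ)`, the points `kδ + ρ` sweep disjoint intervals. This makes averaging
over the grid offset possible. -/
theorem sum_lintegral_Ioc_le (F : ℝ → ℝ≥0∞) (hF : Measurable F) {δ : ℝ} (hδ : 0 ≤ δ) (N : ℕ) :
    ∫⁻ ρ in Set.Ioo 0 δ, ∑ k ∈ Finset.range N, F (k * δ + ρ) ≤ ∫⁻ x, F x := by
  rw [lintegral_finsetSum _ fun k _ => by fun_prop]
  have h : ∀ n : ℕ, ∑ k ∈ Finset.range n, ∫⁻ ρ in Set.Ioo 0 δ, F (k * δ + ρ) ≤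
      ∫⁻ x in Set.Ioc 0 (n * δ), F x := by
    intro n
    induction n with
    | zero => simp
    | succ n ih =>
      have hn : (0 : ℝ) ≤ n * δ := by positivity
      have hn' : (n : ℝ) * δ ≤ (n + 1 : ℕ) * δ := by push_cast; nlinarith
      rw [Finset.sum_range_succ, ← Set.Ioc_union_Ioc_eq_Ioc hn hn',
        lintegral_union measurableSet_Ioc (Set.Ioc_disjoint_Ioc_of_le le_rfl)]
      refine add_le_add ih ?_
      rw [← lintegral_indicator measurableSet_Ioo, ← lintegral_indicator measurableSet_Ioc,
        ← lintegral_add_left_eq_self (Set.indicator _ F) ((n : ℝ) * δ)]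
      refine lintegral_mono fun x => ?_
      by_cases hx : x ∈ Set.Ioo 0 δ
      swap
      · rw [Set.indicator_of_notMem hx]
        exact zero_le
      rw [Set.indicator_of_mem hx, Set.indicator_of_mem]
      refine ⟨by linarith [hx.1], ?_⟩
      push_cast
      linarith [hx.2]
  exact (h N).trans (setLIntegral_le_lintegral _ _)

end Approximation

/-! ### Sampling on a randomly shifted grid -/

section Approximation

variable {Y : Type*} [NormedAddCommGroup Y]
variable {Ω : Type*} {mΩ : MeasurableSpace Ω} {P : Measure Ω}

theorem measurableEmbedding_coe_nnreal : MeasurableEmbedding (fun t : ℝ≥0 => (t : ℝ)) :=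
  NNReal.isClosedEmbedding_coe.measurableEmbedding

theorem map_timeMeasure : timeMeasure.map (fun t : ℝ≥0 => (t : ℝ)) = volume.restrict (Set.Ici 0) := by
  rw [timeMeasure, measurableEmbedding_coe_nnreal.map_comap]
  congr 1
  ext x
  simp

theorem setLIntegral_timeMeasure (f : ℝ≥0 → ℝ≥0∞) (s : Set ℝ) (hs : MeasurableSet s)
    (h0 : s ⊆ Set.Ici 0) :
    ∫⁻ t in ((↑) : ℝ≥0 → ℝ) ⁻¹' s, f t ∂timeMeasure = ∫⁻ x in s, f x.toNNReal := by
  have h : ∀ t : ℝ≥0, f t = f (t : ℝ).toNNReal := fun t => by rw [Real.toNNReal_coe]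
  rw [lintegral_congr h, ← measurableEmbedding_coe_nnreal.lintegral_map (μ := timeMeasure.restrict _)
    (fun x : ℝ => f x.toNNReal), ← measurableEmbedding_coe_nnreal.restrict_map, map_timeMeasure,
    Measure.restrict_restrict hs, Set.inter_eq_left.2 h0]

theorem lintegral_Icc_timeMeasure (f : ℝ≥0 → ℝ≥0∞) (t : ℝ≥0) :
    ∫⁻ s in Set.Icc 0 t, f s ∂timeMeasure = ∫⁻ x in Set.Ioc (0 : ℝ) t, f x.toNNReal := by
  rw [setLIntegral_congr Ioc_ae_eq_Icc,
    ← setLIntegral_timeMeasure f _ measurableSet_Icc fun x hx => hx.1]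
  congr 2

/-- The average of `E ‖ψ(a) - ψ(a + v)‖²` over shifted grids is controlled by translations. -/
theorem exists_shift {ψ : ℝ → Ω → Y} [SFinite P]
    (hψ : StronglyMeasurable fun p : ℝ × Ω => ψ p.1 p.2)
    (hfin : ∫⁻ ω, (∫⁻ x, ‖ψ x ω‖ₑ ^ 2) ∂P < ∞) {δ : ℝ} (hδ : 0 < δ) {ε : ℝ≥0∞}
    (hG : ∀ v ∈ Set.Ioc 0 δ, ∫⁻ ω, (∫⁻ x, ‖ψ (x + v) ω - ψ x ω‖ₑ ^ 2) ∂P ≤ ε) (N : ℕ) :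
    ∃ ρ ∈ Set.Ioo 0 δ, (∀ k : ℕ, ∫⁻ ω, ‖ψ (k * δ + ρ) ω‖ₑ ^ 2 ∂P < ∞) ∧
      ∑ k ∈ Finset.range N, ∫⁻ ω, (∫⁻ x in Set.Ioc (k * δ + ρ) (k * δ + ρ + δ),
        ‖ψ x ω - ψ (k * δ + ρ) ω‖ₑ ^ 2) ∂P ≤ ε := by
  have hg : StronglyMeasurable fun p : (ℝ × ℝ) × Ω => ψ (p.1.1 + p.1.2) p.2 - ψ p.1.1 p.2 :=
    (hψ.comp_measurable (g := fun p : (ℝ × ℝ) × Ω => (p.1.1 + p.1.2, p.2)) (by fun_prop)).sub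
      (hψ.comp_measurable (g := fun p : (ℝ × ℝ) × Ω => (p.1.1, p.2)) (by fun_prop))
  obtain ⟨d, hdm, hd⟩ : ∃ d : (ℝ × ℝ) × Ω → ℝ≥0∞, Measurable d ∧
      ∀ a v ω, ‖ψ (a + v) ω - ψ a ω‖ₑ ^ 2 = d ((a, v), ω) :=
    ⟨_, hg.enorm.pow_const 2, fun _ _ _ => rfl⟩
  simp_rw [hd] at hG
  let g : ℝ × ℝ → ℝ≥0∞ := fun q => ∫⁻ ω, d (q, ω) ∂P
  have hgm : Measurable g := hdm.lintegral_prod_right'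
  let F : ℝ → ℝ≥0∞ := fun a => ∫⁻ v in Set.Ioc 0 δ, g (a, v)
  have hF : Measurable F := hgm.lintegral_prod_right'
  -- By Tonelli, integrating over `a` first leaves the translation error at `v`, which is at most
  -- `ε`, integrated over `v` in `(0, δ]`.
  have hFG : ∫⁻ a, F a ≤ ε * ENNReal.ofReal δ := by
    calc ∫⁻ a, F a = ∫⁻ v in Set.Ioc 0 δ, ∫⁻ a, g (a, v) :=
          lintegral_lintegral_swap (f := fun a v => g (a, v)) hgm.aemeasurable
      _ ≤ ∫⁻ v in Set.Ioc 0 δ, ε := by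
        refine setLIntegral_mono measurable_const fun v hv => ?_
        refine le_trans (le_of_eq ?_) (hG v hv)
        refine lintegral_lintegral_swap (f := fun a ω => d ((a, v), ω)) (Measurable.aemeasurable ?_)
        exact hdm.comp (by fun_prop : Measurable fun q : ℝ × Ω => ((q.1, v), q.2))
      _ = ε * ENNReal.ofReal δ := by simp
  -- `F a` is the error of freezing `ψ` at its value at `a` over the cell that follows.
  have hFa : ∀ a, F a = ∫⁻ ω, (∫⁻ x in Set.Ioc a (a + δ), ‖ψ x ω - ψ a ω‖ₑ ^ 2) ∂P := by
    intro a
    have : F a = ∫⁻ ω, (∫⁻ v in Set.Ioc 0 δ, d ((a, v), ω)) ∂P := by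
      refine lintegral_lintegral_swap (f := fun v ω => d ((a, v), ω)) (Measurable.aemeasurable ?_)
      exact hdm.comp (by fun_prop : Measurable fun q : ℝ × Ω => ((a, q.1), q.2))
    rw [this]
    refine lintegral_congr fun ω => ?_
    rw [← lintegral_indicator measurableSet_Ioc, ← lintegral_indicator measurableSet_Ioc,
      ← lintegral_add_left_eq_self ((Set.Ioc a (a + δ)).indicator _) a]
    refine lintegral_congr fun v => ?_
    simp [Set.indicator_apply, hd]
  have hfin' : ∀ᵐ x : ℝ, ∫⁻ ω, ‖ψ x ω‖ₑ ^ 2 ∂P < ∞ := by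
    have hm : Measurable fun p : ℝ × Ω => ‖ψ p.1 p.2‖ₑ ^ 2 := hψ.enorm.pow_const 2
    refine ae_lt_top hm.lintegral_prod_right' ?_
    rw [lintegral_lintegral_swap (f := fun x ω => ‖ψ x ω‖ₑ ^ 2) hm.aemeasurable]
    exact hfin.ne
  have hfin2 : ∀ᵐ ρ : ℝ, ∀ k : ℕ, ∫⁻ ω, ‖ψ (k * δ + ρ) ω‖ₑ ^ 2 ∂P < ∞ :=
    ae_all_iff.2 fun k =>
      (measurePreserving_add_left volume ((k : ℝ) * δ)).quasiMeasurePreserving.ae hfin'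
  have hae : ∀ᵐ ρ ∂(volume.restrict (Set.Ioo 0 δ)), ρ ∈ Set.Ioo 0 δ ∧
      ∀ k : ℕ, ∫⁻ ω, ‖ψ (k * δ + ρ) ω‖ₑ ^ 2 ∂P < ∞ :=
    (ae_restrict_mem measurableSet_Ioo).and (ae_restrict_of_ae hfin2)
  have hne : (volume.restrict (Set.Ioo 0 δ)) ≠ 0 := by
    rw [Ne, Measure.restrict_eq_zero]
    simp [hδ]
  -- The mean over `ρ` of the total freezing error is at most `ε δ / δ`. Some offset outside the
  -- null set of bad samples does no worse than the mean.
  obtain ⟨ρ, hρ, hle⟩ := exists_notMem_null_le_laverage hne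
    (f := fun ρ => ∑ k ∈ Finset.range N, F (k * δ + ρ)) (by fun_prop) (ae_iff.1 hae)
  rw [Set.mem_ofPred_eq, not_not] at hρ
  refine ⟨ρ, hρ.1, hρ.2, ?_⟩
  simp_rw [← hFa]
  refine hle.trans ?_
  rw [laverage_eq, Measure.restrict_apply_univ, Real.volume_Ioo, sub_zero]
  refine ENNReal.div_le_of_le_mul ?_
  exact (sum_lintegral_Ioc_le F hF hδ.le N).trans hFG

set_option maxHeartbeats 1000000 in
/-- A measurable adapted process that is square integrable on `[0, t] × Ω` is approximated by simple
adapted processes. -/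
theorem exists_simpleProcess_le {ℱ : Filtration ℝ≥0 mΩ} [SFinite P] [InnerProductSpace ℝ Y]
    {φ : ℝ≥0 → Ω → Y} {t : ℝ≥0}
    (hφ : StronglyMeasurable fun p : Set.Icc (0 : ℝ≥0) t × Ω => φ p.1 p.2)
    (had : ∀ s ≤ t, StronglyMeasurable[ℱ s] (φ s))
    (hfin : ∫⁻ ω, (∫⁻ s in Set.Icc 0 t, ‖φ s ω‖ₑ ^ 2 ∂timeMeasure) ∂P < ∞)
    {ε : ℝ≥0∞} (hε : ε ≠ 0) :
    ∃ S : SimpleProcess ℱ P Y,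
      ∫⁻ ω, (∫⁻ s in Set.Icc 0 t, ‖S.eval s ω - φ s ω‖ₑ ^ 2 ∂timeMeasure) ∂P ≤ ε := by
  -- Extension by zero to the real line, where translations act.
  let ψ : ℝ → Ω → Y := fun x ω => (Set.Ioc 0 (t : ℝ)).indicator (fun x => φ x.toNNReal ω) x
  have hψ : StronglyMeasurable fun p : ℝ × Ω => ψ p.1 p.2 := by
    have h1 : StronglyMeasurable fun p : ℝ × Ω =>
        φ (Set.projIcc 0 t zero_le p.1.toNNReal) p.2 :=
      hφ.comp_measurable
        (g := fun p : ℝ × Ω => (Set.projIcc (0 : ℝ≥0) t zero_le p.1.toNNReal, p.2))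
        ((continuous_projIcc.measurable.comp
          (measurable_real_toNNReal.comp measurable_fst)).prodMk measurable_snd)
    have h2 := h1.indicator (s := Prod.fst ⁻¹' Set.Ioc 0 (t : ℝ)) (measurable_fst measurableSet_Ioc)
    convert h2 using 1
    ext p
    by_cases hp : p.1 ∈ Set.Ioc 0 (t : ℝ)
    · have hp' : p ∈ Prod.fst ⁻¹' Set.Ioc 0 (t : ℝ) := hp
      have hmem : p.1.toNNReal ∈ Set.Icc 0 t := ⟨zero_le, Real.toNNReal_le_iff_le_coe.2 hp.2⟩
      simp only [ψ]
      rw [Set.indicator_of_mem hp, Set.indicator_of_mem hp', Set.projIcc_of_mem _ hmem]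
    · have hp' : p ∉ Prod.fst ⁻¹' Set.Ioc 0 (t : ℝ) := hp
      simp only [ψ]
      rw [Set.indicator_of_notMem hp, Set.indicator_of_notMem hp']
  have hψφ : ∀ x ∈ Set.Ioc 0 (t : ℝ), ∀ ω, ψ x ω = φ x.toNNReal ω := fun x hx ω =>
    Set.indicator_of_mem hx _
  have hψ0 : ∀ x ≤ 0, ∀ ω, ψ x ω = 0 := fun x hx ω =>
    Set.indicator_of_notMem (fun h => absurd h.1 (not_lt.2 hx)) _
  have hψad : ∀ a : ℝ, StronglyMeasurable[ℱ a.toNNReal] (ψ a) := by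
    intro a
    by_cases ha : a ∈ Set.Ioc 0 (t : ℝ)
    · have : ψ a = φ a.toNNReal := funext fun ω => hψφ a ha ω
      rw [this]
      exact had _ (Real.toNNReal_le_iff_le_coe.2 ha.2)
    · have : ψ a = fun _ => 0 := funext fun ω => Set.indicator_of_notMem ha _
      rw [this]
      exact stronglyMeasurable_const
  have hψfin : ∫⁻ ω, (∫⁻ x, ‖ψ x ω‖ₑ ^ 2) ∂P < ∞ := by
    refine lt_of_le_of_lt (le_of_eq (lintegral_congr fun ω => ?_)) hfin
    rw [lintegral_Icc_timeMeasure, ← lintegral_indicator measurableSet_Ioc]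
    refine lintegral_congr fun x => ?_
    by_cases hx : x ∈ Set.Ioc 0 (t : ℝ)
    · rw [Set.indicator_of_mem hx, hψφ x hx]
    · simp [ψ, Set.indicator_of_notMem hx]
  have hε2 : (0 : ℝ≥0∞) < ε / 2 := ENNReal.half_pos hε
  obtain ⟨δ, hδ, hG⟩ : ∃ δ > 0, ∀ v ∈ Set.Ioc 0 δ,
      ∫⁻ ω, (∫⁻ x, ‖ψ (x + v) ω - ψ x ω‖ₑ ^ 2) ∂P ≤ ε / 2 := by
    have := (tendsto_lintegral_lintegral_translate_sub hψ hψfin).eventually (ge_mem_nhds hε2)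
    obtain ⟨δ, hδ, h⟩ := Metric.eventually_nhds_iff.1 this
    refine ⟨δ / 2, half_pos hδ, fun v hv => h ?_⟩
    rw [Real.dist_eq, sub_zero, abs_of_pos hv.1]
    linarith [hv.2]
  -- With `t ≤ N δ` the last grid point `N δ + ρ` lies beyond `t`, so the cells cover `(ρ, t]`.
  obtain ⟨N, hN⟩ := exists_nat_ge ((t : ℝ) / δ)
  rw [div_le_iff₀ hδ] at hN
  obtain ⟨ρ, hρ, hρfin, hsum⟩ := exists_shift hψ hψfin hδ hG N
  let τ : ℕ → ℝ := fun k => k * δ + ρ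
  have hτ : ∀ k, τ (k + 1) = τ k + δ := fun k => by simp only [τ]; push_cast; ring
  have hτmono : Monotone τ := monotone_nat_of_le_succ fun k => by rw [hτ]; linarith
  have hτpos : ∀ k, 0 < τ k := fun k => by
    have : (0 : ℝ) ≤ k * δ := by positivity
    simp only [τ]
    linarith [hρ.1]
  let S : SimpleProcess ℱ P Y :=
    { n := N
      time := fun k => (τ k).toNNReal
      mono := fun i j h => Real.toNNReal_le_toNNReal (hτmono h)
      coeff := fun k => ψ (τ k)
      measurable_coeff := fun k => hψad _
      memLp_coeff := fun k => by
        rw [memLp_two_iff ((hψad _).mono (ℱ.le _)).aestronglyMeasurable]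
        exact hρfin k }
  have hS : ∀ x > 0, ∀ ω, S.eval x.toNNReal ω = ∑ k ∈ Finset.range N,
      (Set.Ioc (τ k) (τ k + δ)).indicator (fun _ => ψ (τ k) ω) x := by
    intro x hx ω
    rw [Finset.sum_range]
    refine Finset.sum_congr rfl fun k _ => ?_
    have hiff : x.toNNReal ∈ Set.Ioc (τ k).toNNReal (τ (k + 1)).toNNReal ↔
        x ∈ Set.Ioc (τ k) (τ k + δ) := by
      rw [Set.mem_Ioc, Set.mem_Ioc, Real.toNNReal_lt_toNNReal_iff hx,
        Real.toNNReal_le_toNNReal_iff (hτpos _).le, hτ]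
    change (Set.Ioc (τ k).toNNReal (τ (k + 1)).toNNReal).indicator (fun _ => ψ (τ k) ω) _ = _
    simp only [Set.indicator_apply, hiff]
  refine ⟨S, ?_⟩
  have hpt : ∀ ω, ∀ x ∈ Set.Ioc 0 (t : ℝ), ‖S.eval x.toNNReal ω - φ x.toNNReal ω‖ₑ ^ 2 ≤
      (Set.Ioc 0 ρ).indicator (fun x => ‖ψ x ω‖ₑ ^ 2) x + ∑ k ∈ Finset.range N,
        (Set.Ioc (τ k) (τ k + δ)).indicator (fun x => ‖ψ x ω - ψ (τ k) ω‖ₑ ^ 2) x := by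
    intro ω x hx
    rw [hS x hx.1, ← hψφ x hx]
    by_cases hxρ : x ≤ ρ
    · rw [Set.indicator_of_mem (show x ∈ Set.Ioc 0 ρ from ⟨hx.1, hxρ⟩), Finset.sum_eq_zero, zero_sub,
        enorm_neg]
      · exact le_self_add
      · intro k _
        refine Set.indicator_of_notMem (fun h => ?_) _
        have : (0 : ℝ) ≤ k * δ := by positivity
        have := h.1
        simp only [τ] at this
        linarith
    · have hmem : x ∈ Set.Ioc (τ 0) (τ N) := by
        simp only [τ, Nat.cast_zero, zero_mul, zero_add]
        exact ⟨not_le.1 hxρ, by linarith [hx.2, hρ.1]⟩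
      obtain ⟨k, hk, hxk⟩ := exists_mem_Ioc_of_mem_Ioc hmem
      have hxk' := hxk
      rw [hτ] at hxk
      rw [Finset.sum_eq_single_of_mem k (Finset.mem_range.2 hk), Set.indicator_of_mem hxk]
      · refine le_add_left ?_
        refine le_trans ?_ (Finset.single_le_sum (fun _ _ => zero_le) (Finset.mem_range.2 hk))
        rw [Set.indicator_of_mem hxk, ← enorm_neg, neg_sub]
      · intro j _ hjk
        refine Set.indicator_of_notMem (fun h => ?_) _
        rw [← hτ] at h
        exact (Set.disjoint_left.1 (hτmono.pairwise_disjoint_on_Ioc_succ hjk) h) hxk'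
  have hm0 : Measurable fun p : Ω × ℝ => ‖ψ p.2 p.1‖ₑ ^ 2 :=
    (hψ.comp_measurable measurable_swap).enorm.pow_const 2
  have hm : ∀ c : ℝ, Measurable fun p : Ω × ℝ => ‖ψ p.2 p.1 - ψ c p.1‖ₑ ^ 2 := fun c =>
    ((hψ.comp_measurable measurable_swap).sub
      (hψ.comp_measurable (by fun_prop : Measurable fun p : Ω × ℝ => (c, p.1)))).enorm.pow_const 2
  calc ∫⁻ ω, (∫⁻ s in Set.Icc 0 t, ‖S.eval s ω - φ s ω‖ₑ ^ 2 ∂timeMeasure) ∂P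
      ≤ ∫⁻ ω, ((∫⁻ x in Set.Ioc 0 ρ, ‖ψ x ω‖ₑ ^ 2) + ∑ k ∈ Finset.range N,
          ∫⁻ x in Set.Ioc (τ k) (τ k + δ), ‖ψ x ω - ψ (τ k) ω‖ₑ ^ 2) ∂P := by
        refine lintegral_mono fun ω => ?_
        rw [lintegral_Icc_timeMeasure]
        refine (setLIntegral_mono' measurableSet_Ioc (hpt ω)).trans ?_
        refine (setLIntegral_le_lintegral _ _).trans (le_of_eq ?_)
        have hm0ω : Measurable fun x => ‖ψ x ω‖ₑ ^ 2 := hm0.comp measurable_prodMk_left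
        have hmω : ∀ c, Measurable fun x => ‖ψ x ω - ψ c ω‖ₑ ^ 2 := fun c =>
          (hm c).comp measurable_prodMk_left
        rw [lintegral_add_left (hm0ω.indicator measurableSet_Ioc),
          lintegral_finsetSum _ fun k _ => (hmω (τ k)).indicator measurableSet_Ioc]
        simp_rw [lintegral_indicator measurableSet_Ioc]
    _ = ∫⁻ ω, (∫⁻ x in Set.Ioc 0 ρ, ‖ψ x ω‖ₑ ^ 2) ∂P + ∑ k ∈ Finset.range N,
          ∫⁻ ω, (∫⁻ x in Set.Ioc (τ k) (τ k + δ), ‖ψ x ω - ψ (τ k) ω‖ₑ ^ 2) ∂P := by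
        rw [lintegral_add_left hm0.lintegral_prod_right',
          lintegral_finsetSum _ fun k _ => (hm (τ k)).lintegral_prod_right']
    _ ≤ ε / 2 + ε / 2 := by
        -- Before the first grid point `S` vanishes, leaving the error `∫ ‖ψ‖²` over `(0, ρ]`. Since
        -- `ρ < δ` and `ψ = 0` on `(-∞, 0]`, this is part of the translation error at `δ`.
        refine add_le_add ?_ hsum
        refine le_trans (lintegral_mono fun ω => ?_) (hG δ ⟨hδ, le_rfl⟩)
        rw [← lintegral_indicator measurableSet_Ioc,
          ← lintegral_sub_right_eq_self (fun x => ‖ψ (x + δ) ω - ψ x ω‖ₑ ^ 2) δ]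
        refine lintegral_mono fun x => ?_
        by_cases hx : x ∈ Set.Ioc 0 ρ
        · rw [Set.indicator_of_mem hx, sub_add_cancel, hψ0 (x - δ) (by linarith [hx.2, hρ.2]),
            sub_zero]
        · rw [Set.indicator_of_notMem hx]
          exact zero_le
    _ = ε := ENNReal.add_halves ε

end Approximation

/-! ### Increments of Wiener processes -/

section Increments

variable {Ω : Type*} {mΩ : MeasurableSpace Ω} {P : Measure Ω} {ℱ : Filtration ℝ≥0 mΩ}
  {β β' : ℝ≥0 → Ω → ℝ}

/-- The increment `β(t) - β(s)`. -/
def increment (β : ℝ≥0 → Ω → ℝ) (s t : ℝ≥0) (ω : Ω) : ℝ := β t ω - β s ω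

theorem increment_add (β : ℝ≥0 → Ω → ℝ) (s t u : ℝ≥0) (ω : Ω) :
    increment β s t ω + increment β t u ω = increment β s u ω := by
  simp only [increment]
  ring

@[simp]
theorem increment_self (β : ℝ≥0 → Ω → ℝ) (s : ℝ≥0) (ω : Ω) : increment β s s ω = 0 :=
  sub_self _

namespace IsWiener

theorem stronglyMeasurable_increment (h : IsWiener ℱ P β) {s t u : ℝ≥0} (hs : s ≤ u) (ht : t ≤ u) :
    StronglyMeasurable[ℱ u] (increment β s t) :=
  ((h.adapted t).mono (ℱ.mono ht)).sub ((h.adapted s).mono (ℱ.mono hs))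

theorem measurable_increment (h : IsWiener ℱ P β) (s t : ℝ≥0) : Measurable (increment β s t) :=
  ((h.stronglyMeasurable_increment (le_max_left s t) (le_max_right s t)).mono (ℱ.le _)).measurable

theorem hasLaw_increment (h : IsWiener ℱ P β) (s t : ℝ≥0) :
    HasLaw (increment β s t) (gaussianReal 0 (nndist t.1 s.1)) P :=
  h.isBrownian.toIsPreBrownianReal.hasLaw_sub t s

theorem memLp_increment (h : IsWiener ℱ P β) (s t : ℝ≥0) : MemLp (increment β s t) 2 P :=
  (h.hasLaw_increment s t).hasGaussianLaw.memLp_two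

theorem integral_increment (h : IsWiener ℱ P β) (s t : ℝ≥0) : ∫ ω, increment β s t ω ∂P = 0 := by
  rw [(h.hasLaw_increment s t).integral_eq, integral_id_gaussianReal]

theorem integral_increment_sq (h : IsWiener ℱ P β) {s t : ℝ≥0} (hst : s ≤ t) :
    ∫ ω, increment β s t ω ^ 2 ∂P = t - s := by
  have h1 := (h.hasLaw_increment s t).variance_eq
  have := (h.hasLaw_increment s t).isProbabilityMeasure
  rw [variance_id_gaussianReal, variance_of_integral_eq_zero
    (h.measurable_increment s t).aemeasurable (h.integral_increment s t), coe_nndist,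
    Real.dist_eq] at h1
  exact h1.trans (abs_of_nonneg (sub_nonneg.2 (NNReal.coe_le_coe.2 hst)))

theorem indepFun_increment (h : IsWiener ℱ P β) {s t : ℝ≥0} (hst : s ≤ t) {E : Type*}
    [MeasurableSpace E] {X : Ω → E} (hX : Measurable[ℱ s] X) :
    IndepFun X (increment β s t) P := by
  rw [IndepFun_iff_Indep]
  exact indep_of_indep_of_le_left (h.indep_increment s t hst).symm hX.comap_le

theorem integral_mul_increment (h : IsWiener ℱ P β) {s t : ℝ≥0} (hst : s ≤ t) {X : Ω → ℝ}
    (hX : StronglyMeasurable[ℱ s] X) : ∫ ω, X ω * increment β s t ω ∂P = 0 := by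
  rw [(h.indepFun_increment hst hX.measurable).integral_fun_mul_eq_mul_integral
    (hX.mono (ℱ.le _)).aestronglyMeasurable (h.measurable_increment s t).aestronglyMeasurable,
    h.integral_increment, mul_zero]

end IsWiener

variable (P ℱ) in
/-- `c` is the rate of the covariation of `β` and `β'`: the conditional expectation of
`(β(t) - β(s)) (β'(t) - β'(s))` given `ℱ s` is `c (t - s)`. -/
def HasCovariation (β β' : ℝ≥0 → Ω → ℝ) (c : ℝ) : Prop :=
  ∀ s t, s ≤ t → P[fun ω => increment β s t ω * increment β' s t ω | ℱ s] =ᵐ[P]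
    fun _ => c * (t - s)

theorem HasCovariation.symm {c : ℝ} (h : HasCovariation P ℱ β β' c) :
    HasCovariation P ℱ β' β c := fun s t hst => by
  simpa only [mul_comm] using h s t hst

theorem IsWiener.integrable_increment_mul (h : IsWiener ℱ P β) (h' : IsWiener ℱ P β')
    (s t s' t' : ℝ≥0) : Integrable (fun ω => increment β s t ω * increment β' s' t' ω) P :=
  (h.memLp_increment s t).integrable_mul (h'.memLp_increment s' t')

theorem IsWiener.hasCovariation_self [IsProbabilityMeasure P] (h : IsWiener ℱ P β) :
    HasCovariation P ℱ β β 1 := fun s t hst => by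
  have h1 := condExp_indep_eq (μ := P) (f := fun ω => increment β s t ω ^ 2)
    (m₁ := MeasurableSpace.comap (increment β s t) inferInstance)
    (h.measurable_increment s t).comap_le (ℱ.le s)
    ((comap_measurable (increment β s t)).pow_const 2).stronglyMeasurable
    (h.indep_increment s t hst)
  rw [h.integral_increment_sq hst] at h1
  simpa only [one_mul, sq] using h1

theorem integral_sum_sq_of_uncorrelated {D : ℕ → Ω → ℝ} (hD : ∀ p, MemLp (D p) 2 P)
    (h0 : ∀ p q, p < q → ∫ ω, D p ω * D q ω ∂P = 0) (n : ℕ) :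
    ∫ ω, (∑ p ∈ Finset.range n, D p ω) ^ 2 ∂P = ∑ p ∈ Finset.range n, ∫ ω, D p ω ^ 2 ∂P := by
  have hint : ∀ p q, Integrable (fun ω => D p ω * D q ω) P := fun p q =>
    (hD p).integrable_mul (hD q)
  have h0' : ∀ p q, p ≠ q → ∫ ω, D p ω * D q ω ∂P = 0 := fun p q hpq => by
    rcases lt_or_gt_of_ne hpq with h | h
    · exact h0 p q h
    · simpa only [mul_comm] using h0 q p h
  simp_rw [sq, Finset.sum_mul_sum]
  rw [integral_finsetSum _ fun p _ => integrable_finsetSum _ fun q _ => hint p q]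
  refine Finset.sum_congr rfl fun p hp => ?_
  rw [integral_finsetSum _ fun q _ => hint p q, Finset.sum_eq_single_of_mem p hp]
  exact fun q _ hq => h0' p q hq.symm

/-- This rests on `|f| ≤ (f² + ε²) / (2ε)`. -/
theorem abs_setIntegral_le_of_integral_sq_le [IsProbabilityMeasure P] {f : Ω → ℝ} (hf : MemLp f 2 P)
    {A : Set Ω} {ε : ℝ} (hε : 0 < ε) (h : ∫ ω, f ω ^ 2 ∂P ≤ ε ^ 2) :
    |∫ ω in A, f ω ∂P| ≤ ε := by
  have h1 : Integrable f P := hf.integrable (by norm_num)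
  calc |∫ ω in A, f ω ∂P| ≤ ∫ ω in A, |f ω| ∂P := abs_integral_le_integral_abs
    _ ≤ ∫ ω, |f ω| ∂P := setIntegral_le_integral h1.abs (Eventually.of_forall fun _ => abs_nonneg _)
    _ ≤ ∫ ω, (2 * ε)⁻¹ * (f ω ^ 2 + ε ^ 2) ∂P := by
      refine integral_mono h1.abs ((hf.integrable_sq.add (integrable_const _)).const_mul _) ?_
      intro ω
      change |f ω| ≤ (2 * ε)⁻¹ * (f ω ^ 2 + ε ^ 2)
      rw [inv_mul_eq_div, le_div_iff₀ (by positivity), ← sq_abs (f ω)]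
      nlinarith [sq_nonneg (|f ω| - ε)]
    _ ≤ ε := by
      rw [integral_const_mul, integral_add hf.integrable_sq (integrable_const _), integral_const,
        probReal_univ, one_smul, inv_mul_eq_div, div_le_iff₀ (by positivity)]
      linarith

/-- Cross terms pair an increment over `(u, v]` with a factor known at time `u`, so they integrate
to zero over a set of `ℱ a`; only the products over equal subintervals remain. -/
theorem setIntegral_increment_mul (h : IsWiener ℱ P β) (h' : IsWiener ℱ P β') {a : ℝ≥0}
    {A : Set Ω} (hA : MeasurableSet[ℱ a] A) (δ : ℝ≥0) (n : ℕ) :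
    ∫ ω in A, increment β a (a + n * δ) ω * increment β' a (a + n * δ) ω ∂P =
      ∫ ω in A, ∑ p ∈ Finset.range n, increment β (a + p * δ) (a + (p + 1 : ℕ) * δ) ω *
        increment β' (a + p * δ) (a + (p + 1 : ℕ) * δ) ω ∂P := by
  have hmix : ∀ {γ γ' : ℝ≥0 → Ω → ℝ}, IsWiener ℱ P γ → IsWiener ℱ P γ' → ∀ {u v : ℝ≥0}, a ≤ u →
      u ≤ v → ∫ ω in A, increment γ a u ω * increment γ' u v ω ∂P = 0 := by
    intro γ γ' hγ hγ' u v hau huv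
    rw [← integral_indicator (ℱ.le a _ hA)]
    have hX : StronglyMeasurable[ℱ u] (A.indicator (increment γ a u)) :=
      (hγ.stronglyMeasurable_increment hau le_rfl).indicator (ℱ.mono hau _ hA)
    rw [← hγ'.integral_mul_increment huv hX]
    refine integral_congr_ae (Eventually.of_forall fun ω => ?_)
    exact Set.indicator_mul_left A (increment γ a u) (increment γ' u v)
  have hint : ∀ p : ℕ, IntegrableOn (fun ω => increment β (a + p * δ) (a + (p + 1 : ℕ) * δ) ω *
        increment β' (a + p * δ) (a + (p + 1 : ℕ) * δ) ω) A P := fun p =>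
    (h.integrable_increment_mul h' _ _ _ _).integrableOn
  induction n with
  | zero => simp
  | succ n ih =>
    set u := a + n * δ
    set v := a + (n + 1 : ℕ) * δ
    have hau : a ≤ u := le_self_add
    have huv : u ≤ v := by
      simp only [u, v]
      gcongr
      exact n.le_succ
    have hdec : ∀ ω, increment β a v ω * increment β' a v ω =
        increment β a u ω * increment β' a u ω + increment β a u ω * increment β' u v ω +
        increment β' a u ω * increment β u v ω + increment β u v ω * increment β' u v ω := by
      intro ω
      rw [← increment_add β a u v, ← increment_add β' a u v]
      ring
    simp_rw [Finset.sum_range_succ, hdec]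
    have i1 := (h.integrable_increment_mul h' a u a u).integrableOn (s := A)
    have i2 := (h.integrable_increment_mul h' a u u v).integrableOn (s := A)
    have i3 := (h'.integrable_increment_mul h a u u v).integrableOn (s := A)
    have i4 := (h.integrable_increment_mul h' u v u v).integrableOn (s := A)
    have i12 : IntegrableOn (fun ω => increment β a u ω * increment β' a u ω +
      increment β a u ω * increment β' u v ω) A P := i1.add i2
    have i123 : IntegrableOn (fun ω => increment β a u ω * increment β' a u ω +
      increment β a u ω * increment β' u v ω + increment β' a u ω * increment β u v ω) A P :=
      i12.add i3
    rw [integral_add i123 i4, integral_add i12 i3, integral_add i1 i2,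
      integral_add (integrable_finsetSum _ fun p _ => hint p) i4, ih, hmix h h' hau huv,
      hmix h' h hau huv, add_zero, add_zero]

theorem memLp_increment_mul (h : IsWiener ℱ P β) (h' : IsWiener ℱ P β')
    (hind : IndepFun (fun ω t => β t ω) (fun ω t => β' t ω) P) (s t : ℝ≥0) :
    MemLp (fun ω => increment β s t ω * increment β' s t ω) 2 P := by
  refine (memLp_two_iff_integrable_sq
    ((h.measurable_increment _ _).mul (h'.measurable_increment _ _)).aestronglyMeasurable).2 ?_
  simp_rw [Pi.mul_apply, mul_pow]
  have hF : Measurable fun x : ℝ≥0 → ℝ => (x t - x s) ^ 2 := by fun_prop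
  exact (hind.comp hF hF).integrable_mul (h.memLp_increment s t).integrable_sq
    (h'.memLp_increment s t).integrable_sq

/-- Independence of the two paths factors each expectation into a `β` part and a `β'` part. Diagonal
terms give `δ · δ`, and off-diagonal ones vanish already in the `β` factor. -/
theorem integral_sq_sum_increment_mul (h : IsWiener ℱ P β) (h' : IsWiener ℱ P β')
    (hind : IndepFun (fun ω t => β t ω) (fun ω t => β' t ω) P) (a δ : ℝ≥0) (n : ℕ) :
    ∫ ω, (∑ p ∈ Finset.range n, increment β (a + p * δ) (a + (p + 1 : ℕ) * δ) ω *
      increment β' (a + p * δ) (a + (p + 1 : ℕ) * δ) ω) ^ 2 ∂P = n * (δ : ℝ) ^ 2 := by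
  set τ : ℕ → ℝ≥0 := fun p => a + p * δ with hτ
  have hτm : Monotone τ := fun p q hpq => by
    simp only [hτ]
    gcongr
  have hτs : ∀ p, (τ (p + 1) : ℝ) - τ p = δ := fun p => by
    simp only [hτ]; push_cast; ring
  have hprod : ∀ F G : (ℝ≥0 → ℝ) → ℝ, Measurable F → Measurable G →
      ∫ ω, F (fun t => β t ω) * G (fun t => β' t ω) ∂P =
        (∫ ω, F (fun t => β t ω) ∂P) * ∫ ω, G (fun t => β' t ω) ∂P := by
    intro F G hF hG
    have hm : Measurable fun ω t => β t ω :=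
      measurable_pi_lambda _ fun t => ((h.adapted t).mono (ℱ.le t)).measurable
    have hm' : Measurable fun ω t => β' t ω :=
      measurable_pi_lambda _ fun t => ((h'.adapted t).mono (ℱ.le t)).measurable
    exact (hind.comp hF hG).integral_fun_mul_eq_mul_integral
      (hF.comp hm).aestronglyMeasurable (hG.comp hm').aestronglyMeasurable
  rw [integral_sum_sq_of_uncorrelated fun p => memLp_increment_mul h h' hind _ _]
  · have hp : ∀ p, ∫ ω, (increment β (τ p) (τ (p + 1)) ω *
      increment β' (τ p) (τ (p + 1)) ω) ^ 2 ∂P = (δ : ℝ) ^ 2 := by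
      intro p
      simp_rw [mul_pow]
      refine (hprod (fun x => (x (τ (p + 1)) - x (τ p)) ^ 2)
        (fun x => (x (τ (p + 1)) - x (τ p)) ^ 2) (by fun_prop) (by fun_prop)).trans ?_
      refine (congrArg₂ (· * ·) (h.integral_increment_sq (hτm p.le_succ))
        (h'.integral_increment_sq (hτm p.le_succ))).trans ?_
      rw [hτs, sq]
    change ∑ p ∈ Finset.range n, ∫ ω, (increment β (τ p) (τ (p + 1)) ω *
      increment β' (τ p) (τ (p + 1)) ω) ^ 2 ∂P = _
    simp only [hp]
    simp
  · intro p q hpq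
    have : ∀ ω, increment β (τ p) (τ (p + 1)) ω * increment β' (τ p) (τ (p + 1)) ω *
        (increment β (τ q) (τ (q + 1)) ω * increment β' (τ q) (τ (q + 1)) ω) =
        (increment β (τ p) (τ (p + 1)) ω * increment β (τ q) (τ (q + 1)) ω) *
        (increment β' (τ p) (τ (p + 1)) ω * increment β' (τ q) (τ (q + 1)) ω) := fun ω => by ring
    refine (integral_congr_ae (Eventually.of_forall this)).trans ?_
    refine (hprod (fun x => (x (τ (p + 1)) - x (τ p)) * (x (τ (q + 1)) - x (τ q)))
      (fun x => (x (τ (p + 1)) - x (τ p)) * (x (τ (q + 1)) - x (τ q)))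
      (by fun_prop) (by fun_prop)).trans ?_
    refine mul_eq_zero_of_left (h.integral_mul_increment (hτm q.le_succ)
      (h.stronglyMeasurable_increment (hτm hpq.le) (hτm hpq))) _

/-- Independent Wiener processes with respect to the same filtration have covariation zero. -/
theorem IsWiener.hasCovariation_zero (h : IsWiener ℱ P β) (h' : IsWiener ℱ P β')
    (hind : IndepFun (fun ω t => β t ω) (fun ω t => β' t ω) P) :
    HasCovariation P ℱ β β' 0 := by
  have := (h.hasLaw_increment 0 0).isProbabilityMeasure
  intro a b hab
  simp only [zero_mul]
  refine (ae_eq_condExp_of_forall_setIntegral_eq (ℱ.le a) (h.integrable_increment_mul h' _ _ _ _)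
    (fun A _ _ => integrableOn_zero) (fun A hA _ => ?_)
    stronglyMeasurable_const.aestronglyMeasurable).symm
  rw [integral_zero, eq_comm, ← abs_eq_zero]
  refine le_antisymm (le_of_forall_pos_le_add fun ε hε => ?_) (abs_nonneg _)
  rw [zero_add]
  -- With `n + 1` subintervals the sum of products has second moment `(b - a)² / (n + 1)`, to be
  -- made at most `ε²`.
  obtain ⟨n, hn⟩ := exists_nat_ge (((b : ℝ) - a) ^ 2 / ε ^ 2)
  have hn1 : ((b : ℝ) - a) ^ 2 ≤ (n + 1) * ε ^ 2 := by
    rw [div_le_iff₀ (by positivity)] at hn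
    nlinarith [sq_nonneg ε]
  set δ : ℝ≥0 := (b - a) / (n + 1) with hδ
  have hδ1 : ((n : ℝ) + 1) * δ = b - a := by
    rw [hδ]
    push_cast [NNReal.coe_sub hab]
    field_simp
  have hb : a + (n + 1 : ℕ) * δ = b := by
    rw [← NNReal.coe_inj]
    push_cast
    rw [hδ1]
    ring
  have h2 : ∫ ω, (∑ p ∈ Finset.range (n + 1), increment β (a + p * δ) (a + (p + 1 : ℕ) * δ) ω *
      increment β' (a + p * δ) (a + (p + 1 : ℕ) * δ) ω) ^ 2 ∂P ≤ ε ^ 2 := by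
    rw [integral_sq_sum_increment_mul h h' hind]
    have h3 : ((n : ℝ) + 1) * ((n + 1 : ℕ) * (δ : ℝ) ^ 2) = (b - a) ^ 2 := by
      rw [← hδ1]
      push_cast
      ring
    have h4 : (0 : ℝ) < n + 1 := by positivity
    nlinarith
  have h1 := setIntegral_increment_mul h h' hA δ (n + 1)
  rw [hb] at h1
  rw [h1]
  exact abs_setIntegral_le_of_integral_sq_le (memLp_finsetSum _ fun p _ =>
    memLp_increment_mul h h' hind _ _) hε h2

end Increments

/-! ### The Itô isometry -/

section Isometry

variable {Ω : Type*} {mΩ : MeasurableSpace Ω} {P : Measure Ω} {ℱ : Filtration ℝ≥0 mΩ}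
  {β β' : ℝ≥0 → Ω → ℝ} {c : ℝ}
  {Y : Type*} [NormedAddCommGroup Y] [InnerProductSpace ℝ Y]

theorem integrable_inner_of_memLp {f g : Ω → Y} (hf : MemLp f 2 P) (hg : MemLp g 2 P) :
    Integrable (fun ω => ⟪f ω, g ω⟫_ℝ) P :=
  (hf.norm.integrable_mul hg.norm).mono' (hf.1.inner hg.1)
    (Eventually.of_forall fun _ => abs_real_inner_le_norm _ _)

/-- Independence of `ξ` and the later increment makes the expected square a product; no bound on `ξ`
is needed. -/
theorem IsWiener.memLp_increment_smul (h : IsWiener ℱ P β) {a b : ℝ≥0} (hab : a ≤ b) {ξ : Ω → Y}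
    (hξ : StronglyMeasurable[ℱ a] ξ) (hξ2 : MemLp ξ 2 P) :
    MemLp (fun ω => increment β a b ω • ξ ω) 2 P := by
  have hm : AEStronglyMeasurable (fun ω => increment β a b ω • ξ ω) P :=
    (h.measurable_increment a b).aestronglyMeasurable.smul hξ2.1
  rw [memLp_two_iff hm]
  have h1 : Measurable[ℱ a] fun ω => ‖ξ ω‖ₑ ^ 2 := hξ.enorm.pow_const 2
  have hi := (h.indepFun_increment hab h1).comp measurable_id
    (by fun_prop : Measurable fun x : ℝ => ‖x‖ₑ ^ 2)
  simp_rw [enorm_smul, mul_pow, mul_comm (‖increment β a b _‖ₑ ^ 2)]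
  have := lintegral_mul_eq_lintegral_mul_lintegral_of_indepFun (h1.mono (ℱ.le a) le_rfl)
    ((h.measurable_increment a b).enorm.pow_const 2) hi
  refine lt_of_eq_of_lt this (ENNReal.mul_lt_top ?_ ?_)
  · exact (memLp_two_iff hξ2.1).1 hξ2
  · exact (memLp_two_iff (h.memLp_increment a b).1).1 (h.memLp_increment a b)

theorem IsWiener.integral_inner_of_le (h : IsWiener ℱ P β) (h' : IsWiener ℱ P β') {a b d e : ℝ≥0}
    (hab : a ≤ b) (hbd : b ≤ d) (hde : d ≤ e) {ξ η : Ω → Y} (hξ : StronglyMeasurable[ℱ a] ξ)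
    (hη : StronglyMeasurable[ℱ d] η) :
    ∫ ω, ⟪increment β a b ω • ξ ω, increment β' d e ω • η ω⟫_ℝ ∂P = 0 := by
  have hX : StronglyMeasurable[ℱ d] fun ω => increment β a b ω * ⟪ξ ω, η ω⟫_ℝ :=
    (h.stronglyMeasurable_increment (hab.trans hbd) hbd).mul
      ((hξ.mono (ℱ.mono (hab.trans hbd))).inner hη)
  rw [← h'.integral_mul_increment hde hX]
  refine integral_congr_ae (Eventually.of_forall fun ω => ?_)
  simp only [inner_smul_left, inner_smul_right, RCLike.conj_to_real]
  ring

theorem integral_inner_same_interval [IsProbabilityMeasure P] (h : IsWiener ℱ P β)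
    (h' : IsWiener ℱ P β')
    (hc : HasCovariation P ℱ β β' c) {a b : ℝ≥0} (hab : a ≤ b) {ξ η : Ω → Y}
    (hξ : StronglyMeasurable[ℱ a] ξ) (hξ2 : MemLp ξ 2 P)
    (hη : StronglyMeasurable[ℱ a] η) (hη2 : MemLp η 2 P) :
    ∫ ω, ⟪increment β a b ω • ξ ω, increment β' a b ω • η ω⟫_ℝ ∂P =
      c * (b - a) * ∫ ω, ⟪ξ ω, η ω⟫_ℝ ∂P := by
  have heq : (fun ω => ⟪increment β a b ω • ξ ω, increment β' a b ω • η ω⟫_ℝ) =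
      (fun ω => ⟪ξ ω, η ω⟫_ℝ) * fun ω => increment β a b ω * increment β' a b ω := by
    ext ω
    simp only [inner_smul_left, inner_smul_right, RCLike.conj_to_real, Pi.mul_apply]
    ring
  have hi := integrable_inner_of_memLp (h.memLp_increment_smul hab hξ hξ2)
    (h'.memLp_increment_smul hab hη hη2)
  rw [heq] at hi ⊢
  rw [← integral_condExp (ℱ.le a), integral_congr_ae (condExp_mul_of_stronglyMeasurable_left
    (hξ.inner hη) hi (h.integrable_increment_mul h' _ _ _ _)), mul_comm (c * _),
    ← integral_mul_const]
  refine integral_congr_ae ?_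
  filter_upwards [hc a b hab] with ω hω
  rw [Pi.mul_apply, hω]

theorem integral_inner_same_start [IsProbabilityMeasure P] (h : IsWiener ℱ P β)
    (h' : IsWiener ℱ P β')
    (hc : HasCovariation P ℱ β β' c) {a b e : ℝ≥0} (hab : a ≤ b) (hbe : b ≤ e) {ξ η : Ω → Y}
    (hξ : StronglyMeasurable[ℱ a] ξ) (hξ2 : MemLp ξ 2 P)
    (hη : StronglyMeasurable[ℱ a] η) (hη2 : MemLp η 2 P) :
    ∫ ω, ⟪increment β a b ω • ξ ω, increment β' a e ω • η ω⟫_ℝ ∂P =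
      c * (b - a) * ∫ ω, ⟪ξ ω, η ω⟫_ℝ ∂P := by
  have hηb := hη.mono (ℱ.mono hab)
  simp_rw [← increment_add β' a b e, add_smul, inner_add_right]
  rw [integral_add, integral_inner_same_interval h h' hc hab hξ hξ2 hη hη2,
    h.integral_inner_of_le h' hab le_rfl hbe hξ hηb, add_zero]
  · exact integrable_inner_of_memLp (h.memLp_increment_smul hab hξ hξ2)
      (h'.memLp_increment_smul hab hη hη2)
  · exact integrable_inner_of_memLp (h.memLp_increment_smul hab hξ hξ2)
      (h'.memLp_increment_smul hbe hηb hη2)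

theorem timeMeasure_Ioc (a b : ℝ≥0) : timeMeasure (Set.Ioc a b) = ENNReal.ofReal (b - a) := by
  have : Set.Ioc a b = ((↑) : ℝ≥0 → ℝ) ⁻¹' Set.Ioc (a : ℝ) b := by
    ext s
    simp
  have h := setLIntegral_timeMeasure (fun _ => 1) (Set.Ioc (a : ℝ) b) measurableSet_Ioc
    fun x hx => a.2.trans hx.1.le
  rw [← this] at h
  simpa using h

theorem timeMeasure_real_Ioc {a b : ℝ≥0} (hab : a ≤ b) :
    timeMeasure.real (Set.Ioc a b) = b - a := by
  rw [measureReal_def, timeMeasure_Ioc, ENNReal.toReal_ofReal]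
  exact sub_nonneg.2 (NNReal.coe_le_coe.2 hab)

/-- Splitting the first increment at `d` isolates a part before `d`, which contributes zero, and a
part with the same start as the second increment. -/
theorem integral_inner_of_start_le [IsProbabilityMeasure P] (h : IsWiener ℱ P β)
    (h' : IsWiener ℱ P β')
    (hc : HasCovariation P ℱ β β' c) {a b d e : ℝ≥0} (hab : a ≤ b) (hde : d ≤ e) (had : a ≤ d)
    {ξ η : Ω → Y} (hξ : StronglyMeasurable[ℱ a] ξ) (hξ2 : MemLp ξ 2 P)
    (hη : StronglyMeasurable[ℱ d] η) (hη2 : MemLp η 2 P) :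
    ∫ ω, ⟪increment β a b ω • ξ ω, increment β' d e ω • η ω⟫_ℝ ∂P =
      c * timeMeasure.real (Set.Ioc a b ∩ Set.Ioc d e) * ∫ ω, ⟪ξ ω, η ω⟫_ℝ ∂P := by
  rw [Set.Ioc_inter_Ioc, sup_eq_right.2 had]
  rcases le_total b d with hbd | hdb
  · rw [h.integral_inner_of_le h' hab hbd hde hξ hη,
      Set.Ioc_eq_empty (not_lt.2 (inf_le_left.trans hbd))]
    simp
  have hξd := hξ.mono (ℱ.mono had)
  simp_rw [← increment_add β a d b, add_smul, inner_add_left]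
  rw [integral_add, h.integral_inner_of_le h' had le_rfl hde hξ hη, zero_add,
    timeMeasure_real_Ioc (le_inf hdb hde)]
  · rcases le_total b e with hbe | heb
    · rw [inf_eq_left.2 hbe, integral_inner_same_start h h' hc hdb hbe hξd hξ2 hη hη2]
    · rw [inf_eq_right.2 heb]
      simp_rw [real_inner_comm (_ • η _), real_inner_comm (η _)]
      exact integral_inner_same_start h' h hc.symm hde heb hη hη2 hξd hξ2
  · exact integrable_inner_of_memLp (h.memLp_increment_smul had hξ hξ2)
      (h'.memLp_increment_smul hde hη hη2)
  · exact integrable_inner_of_memLp (h.memLp_increment_smul hdb hξd hξ2)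
      (h'.memLp_increment_smul hde hη hη2)

theorem integral_inner_increment_smul [IsProbabilityMeasure P] (h : IsWiener ℱ P β)
    (h' : IsWiener ℱ P β')
    (hc : HasCovariation P ℱ β β' c) {a b d e : ℝ≥0} (hab : a ≤ b) (hde : d ≤ e)
    {ξ η : Ω → Y} (hξ : StronglyMeasurable[ℱ a] ξ) (hξ2 : MemLp ξ 2 P)
    (hη : StronglyMeasurable[ℱ d] η) (hη2 : MemLp η 2 P) :
    ∫ ω, ⟪increment β a b ω • ξ ω, increment β' d e ω • η ω⟫_ℝ ∂P =
      c * timeMeasure.real (Set.Ioc a b ∩ Set.Ioc d e) * ∫ ω, ⟪ξ ω, η ω⟫_ℝ ∂P := by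
  rcases le_total a d with had | hda
  · exact integral_inner_of_start_le h h' hc hab hde had hξ hξ2 hη hη2
  · simp_rw [real_inner_comm (_ • η _), real_inner_comm (η _)]
    rw [Set.inter_comm]
    exact integral_inner_of_start_le h' h hc.symm hde hab hda hη hη2 hξ hξ2

/-- The data of the process `∑ᵢ 1_{(aᵢ, bᵢ]} ξᵢ` with adapted square integrable `ξᵢ`; the
intervals may overlap. -/
structure IsStep {ι : Type*} (P : Measure Ω) (ℱ : Filtration ℝ≥0 mΩ) (a b : ι → ℝ≥0)
    (ξ : ι → Ω → Y) : Prop where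
  le : ∀ i, a i ≤ b i
  measurable : ∀ i, StronglyMeasurable[ℱ (a i)] (ξ i)
  memLp : ∀ i, MemLp (ξ i) 2 P

/-- The value of `∑ᵢ 1_{(aᵢ, bᵢ]} ξᵢ`. -/
def stepValue {ι : Type*} [Fintype ι] (a b : ι → ℝ≥0) (ξ : ι → Ω → Y) (s : ℝ≥0) (ω : Ω) : Y :=
  ∑ i, (Set.Ioc (a i) (b i)).indicator (fun _ => ξ i ω) s

/-- The stochastic integral of `∑ᵢ 1_{(aᵢ, bᵢ]} ξᵢ`. -/
def stepIntegral {ι : Type*} [Fintype ι] (β : ℝ≥0 → Ω → ℝ) (a b : ι → ℝ≥0) (ξ : ι → Ω → Y)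
    (ω : Ω) : Y :=
  ∑ i, increment β (a i) (b i) ω • ξ i ω

variable {ι κ : Type*} [Fintype ι] [Fintype κ] {a b : ι → ℝ≥0} {ξ : ι → Ω → Y}
  {d e : κ → ℝ≥0} {η : κ → Ω → Y}

theorem IsStep.memLp_stepIntegral (hS : IsStep P ℱ a b ξ) (h : IsWiener ℱ P β) :
    MemLp (stepIntegral β a b ξ) 2 P :=
  memLp_finsetSum _ fun i _ => h.memLp_increment_smul (hS.le i) (hS.measurable i) (hS.memLp i)

theorem IsStep.integral_inner_stepIntegral [IsProbabilityMeasure P] (hS : IsStep P ℱ a b ξ)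
    (hS' : IsStep P ℱ d e η) (h : IsWiener ℱ P β) (h' : IsWiener ℱ P β')
    (hc : HasCovariation P ℱ β β' c) :
    ∫ ω, ⟪stepIntegral β a b ξ ω, stepIntegral β' d e η ω⟫_ℝ ∂P =
      ∑ i, ∑ j, c * timeMeasure.real (Set.Ioc (a i) (b i) ∩ Set.Ioc (d j) (e j)) *
        ∫ ω, ⟪ξ i ω, η j ω⟫_ℝ ∂P := by
  have hint : ∀ i j, Integrable (fun ω => ⟪increment β (a i) (b i) ω • ξ i ω,
      increment β' (d j) (e j) ω • η j ω⟫_ℝ) P := fun i j =>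
    integrable_inner_of_memLp
      (h.memLp_increment_smul (hS.le i) (hS.measurable i) (hS.memLp i))
      (h'.memLp_increment_smul (hS'.le j) (hS'.measurable j) (hS'.memLp j))
  simp_rw [stepIntegral, sum_inner, inner_sum]
  rw [integral_finsetSum _ fun i _ => integrable_finsetSum _ fun j _ => hint i j]
  refine Finset.sum_congr rfl fun i _ => ?_
  rw [integral_finsetSum _ fun j _ => hint i j]
  exact Finset.sum_congr rfl fun j _ => integral_inner_increment_smul h h' hc (hS.le i) (hS'.le j)
    (hS.measurable i) (hS.memLp i) (hS'.measurable j) (hS'.memLp j)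

theorem lintegral_enorm_sq_eq_ofReal {α E : Type*} [NormedAddCommGroup E] {m : MeasurableSpace α}
    {μ : Measure α} {f : α → E}
    (hf : Integrable (fun x => ‖f x‖ ^ 2) μ) :
    ∫⁻ x, ‖f x‖ₑ ^ 2 ∂μ = ENNReal.ofReal (∫ x, ‖f x‖ ^ 2 ∂μ) := by
  rw [ofReal_integral_eq_lintegral_ofReal hf (Eventually.of_forall fun _ => sq_nonneg _)]
  simp_rw [ENNReal.ofReal_pow (norm_nonneg _), ofReal_norm]

theorem norm_stepValue_sq (s : ℝ≥0) (ω : Ω) : ‖stepValue a b ξ s ω‖ ^ 2 =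
    ∑ i, ∑ j, (Set.Ioc (a i) (b i) ∩ Set.Ioc (a j) (b j)).indicator
      (fun _ => ⟪ξ i ω, ξ j ω⟫_ℝ) s := by
  rw [← real_inner_self_eq_norm_sq, stepValue]
  simp_rw [sum_inner, inner_sum]
  refine Finset.sum_congr rfl fun i _ => Finset.sum_congr rfl fun j _ => ?_
  by_cases hi : s ∈ Set.Ioc (a i) (b i) <;> by_cases hj : s ∈ Set.Ioc (a j) (b j) <;>
    simp only [Set.indicator_apply, Set.mem_inter_iff, hi, hj, and_true, and_false, if_true, if_false, inner_zero_left, inner_zero_right]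

/-- The Itô isometry for step processes. -/
theorem IsStep.lintegral_stepIntegral_sq [IsProbabilityMeasure P] (hS : IsStep P ℱ a b ξ)
    (h : IsWiener ℱ P β) :
    ∫⁻ ω, ‖stepIntegral β a b ξ ω‖ₑ ^ 2 ∂P =
      ∫⁻ ω, (∫⁻ s, ‖stepValue a b ξ s ω‖ₑ ^ 2 ∂timeMeasure) ∂P := by
  have hfin : ∀ i j, timeMeasure (Set.Ioc (a i) (b i) ∩ Set.Ioc (a j) (b j)) ≠ ∞ := fun i j =>
    ne_top_of_le_ne_top (by rw [timeMeasure_Ioc]; exact ENNReal.ofReal_ne_top)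
      (measure_mono Set.inter_subset_left)
  have hmeas : ∀ i j, MeasurableSet (Set.Ioc (a i) (b i) ∩ Set.Ioc (a j) (b j)) := fun i j =>
    measurableSet_Ioc.inter measurableSet_Ioc
  have hint1 : ∀ i j ω, Integrable ((Set.Ioc (a i) (b i) ∩ Set.Ioc (a j) (b j)).indicator
      (fun _ => ⟪ξ i ω, ξ j ω⟫_ℝ)) timeMeasure := fun i j ω =>
    (integrable_indicator_iff (hmeas i j)).2 (integrableOn_const (hfin i j))
  have hint2 : ∀ i j, Integrable (fun ω => timeMeasure.real
      (Set.Ioc (a i) (b i) ∩ Set.Ioc (a j) (b j)) * ⟪ξ i ω, ξ j ω⟫_ℝ) P := fun i j =>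
    (integrable_inner_of_memLp (hS.memLp i) (hS.memLp j)).const_mul _
  -- Pathwise, the time integral is a double sum over overlaps of intervals; its expectation is the
  -- double sum computed for the stochastic integral. Nonnegativity is recorded to pass from the
  -- lower integral to the Bochner integral.
  have htime : ∀ ω, ∫⁻ s, ‖stepValue a b ξ s ω‖ₑ ^ 2 ∂timeMeasure = ENNReal.ofReal
      (∑ i, ∑ j, timeMeasure.real (Set.Ioc (a i) (b i) ∩ Set.Ioc (a j) (b j)) *
        ⟪ξ i ω, ξ j ω⟫_ℝ) ∧ 0 ≤ ∑ i, ∑ j,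
        timeMeasure.real (Set.Ioc (a i) (b i) ∩ Set.Ioc (a j) (b j)) * ⟪ξ i ω, ξ j ω⟫_ℝ := by
    intro ω
    have hi : Integrable (fun s => ‖stepValue a b ξ s ω‖ ^ 2) timeMeasure := by
      simp_rw [norm_stepValue_sq]
      exact integrable_finsetSum _ fun i _ => integrable_finsetSum _ fun j _ => hint1 i j ω
    have heq : ∫ s, ‖stepValue a b ξ s ω‖ ^ 2 ∂timeMeasure = ∑ i, ∑ j,
        timeMeasure.real (Set.Ioc (a i) (b i) ∩ Set.Ioc (a j) (b j)) * ⟪ξ i ω, ξ j ω⟫_ℝ := by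
      simp_rw [norm_stepValue_sq]
      rw [integral_finsetSum _ fun i _ => integrable_finsetSum _ fun j _ => hint1 i j ω]
      refine Finset.sum_congr rfl fun i _ => ?_
      rw [integral_finsetSum _ fun j _ => hint1 i j ω]
      refine Finset.sum_congr rfl fun j _ => ?_
      rw [integral_indicator (hmeas i j), setIntegral_const, smul_eq_mul]
    rw [lintegral_enorm_sq_eq_ofReal hi, heq, ← heq]
    exact ⟨rfl, integral_nonneg fun _ => sq_nonneg _⟩
  simp_rw [fun ω => (htime ω).1]
  rw [← ofReal_integral_eq_lintegral_ofReal
    (integrable_finsetSum _ fun i _ => integrable_finsetSum _ fun j _ => hint2 i j)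
    (Eventually.of_forall fun ω => (htime ω).2),
    lintegral_enorm_sq_eq_ofReal ((memLp_two_iff_integrable_sq_norm
      (hS.memLp_stepIntegral h).1).1 (hS.memLp_stepIntegral h))]
  congr 1
  simp_rw [← real_inner_self_eq_norm_sq]
  rw [hS.integral_inner_stepIntegral hS h h h.hasCovariation_self,
    integral_finsetSum _ fun i _ => integrable_finsetSum _ fun j _ => hint2 i j]
  refine Finset.sum_congr rfl fun i _ => ?_
  rw [integral_finsetSum _ fun j _ => hint2 i j]
  refine Finset.sum_congr rfl fun j _ => ?_
  rw [one_mul, integral_const_mul]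

end Isometry

/-! ### The Itô integral -/

section ItoIntegral

variable {Ω : Type*} {mΩ : MeasurableSpace Ω} {P : Measure Ω} {ℱ : Filtration ℝ≥0 mΩ}
  {β β' : ℝ≥0 → Ω → ℝ} {Y : Type*} [NormedAddCommGroup Y]

namespace SimpleProcess

/-- The left end points of the intervals of `S`, stopped at `t`. -/
def left (S : SimpleProcess ℱ P Y) (t : ℝ≥0) (k : Fin S.n) : ℝ≥0 := min (S.time k.castSucc) t

/-- The right end points of the intervals of `S`, stopped at `t`. -/
def right (S : SimpleProcess ℱ P Y) (t : ℝ≥0) (k : Fin S.n) : ℝ≥0 := min (S.time k.succ) t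

/-- The coefficients of `S` on the intervals that begin before `t`. -/
def stoppedCoeff (S : SimpleProcess ℱ P Y) (t : ℝ≥0) (k : Fin S.n) : Ω → Y :=
  if S.time k.castSucc ≤ t then S.coeff k else 0

/-- An interval starting after `t` collapses to `(t, t]`, while its coefficient need not be `ℱ
t`-measurable. Replacing that coefficient by zero restores adaptedness without changing the
integral. -/
theorem isStep (S : SimpleProcess ℱ P Y) (t : ℝ≥0) :
    IsStep P ℱ (S.left t) (S.right t) (S.stoppedCoeff t) where
  le k := min_le_min_right t (S.mono (Fin.castSucc_lt_succ (i := k)).le)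
  measurable k := by
    rw [stoppedCoeff, left]
    split_ifs with h
    · rw [min_eq_left h]
      exact S.measurable_coeff k
    · exact stronglyMeasurable_zero
  memLp k := by
    rw [stoppedCoeff]
    split_ifs with h
    · exact S.memLp_coeff k
    · exact MemLp.zero'

theorem stepValue_eq (S : SimpleProcess ℱ P Y) {s t : ℝ≥0} (hst : s ≤ t) (ω : Ω) :
    stepValue (S.left t) (S.right t) (S.stoppedCoeff t) s ω = S.eval s ω := by
  refine Finset.sum_congr rfl fun k _ => ?_
  rw [left, right, stoppedCoeff]
  simp only [Set.indicator_apply, Set.mem_Ioc, min_lt_iff, le_min_iff, hst, and_true,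
    not_lt.2 hst, or_false]
  split_ifs with h1 h2
  · rfl
  · exact absurd (h1.1.le.trans hst) h2
  · rfl

variable [InnerProductSpace ℝ Y]

theorem stepIntegral_eq (S : SimpleProcess ℱ P Y) (β : ℝ≥0 → Ω → ℝ) (t : ℝ≥0) :
    stepIntegral β (S.left t) (S.right t) (S.stoppedCoeff t) = S.integral β t := by
  ext ω
  refine Finset.sum_congr rfl fun k _ => ?_
  rw [increment, left, right, stoppedCoeff]
  split_ifs with h
  · rfl
  · have h1 : t ≤ S.time k.castSucc := (not_le.1 h).le
    rw [min_eq_right h1, min_eq_right (h1.trans (S.mono (Fin.castSucc_lt_succ (i := k)).le)),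
      sub_self, zero_smul, zero_smul]

theorem memLp_integral (S : SimpleProcess ℱ P Y) (h : IsWiener ℱ P β) (t : ℝ≥0) :
    MemLp (S.integral β t) 2 P := by
  rw [← stepIntegral_eq]
  exact (S.isStep t).memLp_stepIntegral h

theorem integral_inner_eq_zero [IsProbabilityMeasure P] (S S' : SimpleProcess ℱ P Y)
    (h : IsWiener ℱ P β) (h' : IsWiener ℱ P β') (hc : HasCovariation P ℱ β β' 0) (t : ℝ≥0) :
    ∫ ω, ⟪S.integral β t ω, S'.integral β' t ω⟫_ℝ ∂P = 0 := by
  rw [← stepIntegral_eq, ← stepIntegral_eq,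
    (S.isStep t).integral_inner_stepIntegral (S'.isStep t) h h' hc]
  simp

/-- The Itô isometry for the difference of two simple processes. -/
theorem lintegral_integral_sub_sq [IsProbabilityMeasure P] (S S' : SimpleProcess ℱ P Y)
    (h : IsWiener ℱ P β) (t : ℝ≥0) :
    ∫⁻ ω, ‖S.integral β t ω - S'.integral β t ω‖ₑ ^ 2 ∂P =
      ∫⁻ ω, (∫⁻ s in Set.Icc 0 t, ‖S.eval s ω - S'.eval s ω‖ₑ ^ 2 ∂timeMeasure) ∂P := by
  -- The difference is a step process over the disjoint union of the index sets. Since intervals may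
  -- overlap, no common refinement is needed.
  have hstep : IsStep P ℱ (Sum.elim (S.left t) (S'.left t)) (Sum.elim (S.right t) (S'.right t))
      (Sum.elim (S.stoppedCoeff t) fun k => -S'.stoppedCoeff t k) := by
    refine ⟨?_, ?_, ?_⟩ <;> rintro (k | k)
    · exact (S.isStep t).le k
    · exact (S'.isStep t).le k
    · exact (S.isStep t).measurable k
    · exact ((S'.isStep t).measurable k).neg
    · exact (S.isStep t).memLp k
    · exact ((S'.isStep t).memLp k).neg
  have h1 := hstep.lintegral_stepIntegral_sq h
  have h2 : ∀ ω, stepIntegral β (Sum.elim (S.left t) (S'.left t))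
      (Sum.elim (S.right t) (S'.right t))
      (Sum.elim (S.stoppedCoeff t) fun k => -S'.stoppedCoeff t k) ω =
      S.integral β t ω - S'.integral β t ω := fun ω => by
    rw [← stepIntegral_eq, ← stepIntegral_eq]
    simp [stepIntegral, Fintype.sum_sum_type, sub_eq_add_neg]
  have h3 : ∀ s ω, stepValue (Sum.elim (S.left t) (S'.left t))
      (Sum.elim (S.right t) (S'.right t))
      (Sum.elim (S.stoppedCoeff t) fun k => -S'.stoppedCoeff t k) s ω =
      stepValue (S.left t) (S.right t) (S.stoppedCoeff t) s ω -
      stepValue (S'.left t) (S'.right t) (S'.stoppedCoeff t) s ω := fun s ω => by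
    simp only [stepValue, Fintype.sum_sum_type, Sum.elim_inl, Sum.elim_inr, sub_eq_add_neg,
      Pi.neg_apply, ← Finset.sum_neg_distrib]
    congr 1
    refine Finset.sum_congr rfl fun k _ => ?_
    simp only [Set.indicator_apply]
    split_ifs <;> simp
  simp_rw [h2, h3] at h1
  rw [h1]
  refine lintegral_congr fun ω => ?_
  rw [← lintegral_indicator measurableSet_Icc]
  refine lintegral_congr fun s => ?_
  by_cases hs : s ≤ t
  · rw [Set.indicator_of_mem (show s ∈ Set.Icc 0 t from ⟨zero_le, hs⟩), stepValue_eq S hs, stepValue_eq S' hs]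
  · rw [Set.indicator_of_notMem fun hmem => hs hmem.2]
    have : ∀ S : SimpleProcess ℱ P Y,
        stepValue (S.left t) (S.right t) (S.stoppedCoeff t) s ω = 0 := fun S =>
      Finset.sum_eq_zero fun k _ =>
        Set.indicator_of_notMem (fun hmem => hs (hmem.2.trans (min_le_right _ _))) _
    simp [this]

/-- The simple process that vanishes identically. -/
def zero (ℱ : Filtration ℝ≥0 mΩ) (P : Measure Ω) (Y : Type*) [NormedAddCommGroup Y] :
    SimpleProcess ℱ P Y where
  n := 0
  time := 0
  mono := monotone_const
  coeff := Fin.elim0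
  measurable_coeff k := k.elim0
  memLp_coeff k := k.elim0

end SimpleProcess

/-- Square integrable measurable adapted processes on `[0, t]`. -/
structure IsItoIntegrand (ℱ : Filtration ℝ≥0 mΩ) (P : Measure Ω) (φ : ℝ≥0 → Ω → Y) (t : ℝ≥0) :
    Prop where
  measurable : StronglyMeasurable fun p : Set.Icc (0 : ℝ≥0) t × Ω => φ p.1 p.2
  adapted : ∀ s ≤ t, StronglyMeasurable[ℱ s] (φ s)
  sq_integrable : ∫⁻ ω, (∫⁻ s in Set.Icc 0 t, ‖φ s ω‖ₑ ^ 2 ∂timeMeasure) ∂P < ∞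

end ItoIntegral

/-! ### Existence, uniqueness and orthogonality of Itô integrals -/

section ItoIntegral

variable {Ω : Type*} {mΩ : MeasurableSpace Ω} {P : Measure Ω} {ℱ : Filtration ℝ≥0 mΩ}
  {β β' : ℝ≥0 → Ω → ℝ} {t : ℝ≥0}

/-- Measurability is known only on `[0, t] × Ω`; precomposing with the projection onto `[0, t]`
gives a globally measurable function with the same integral. -/
theorem measurable_setLIntegral_timeMeasure {f : ℝ≥0 → Ω → ℝ≥0∞}
    (hf : Measurable fun p : Set.Icc (0 : ℝ≥0) t × Ω => f p.1 p.2) :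
    Measurable fun ω => ∫⁻ s in Set.Icc 0 t, f s ω ∂timeMeasure := by
  have h1 : Measurable fun p : ℝ × Ω => f (Set.projIcc 0 t zero_le p.1.toNNReal) p.2 :=
    hf.comp (f := fun p : ℝ × Ω => (Set.projIcc (0 : ℝ≥0) t zero_le p.1.toNNReal, p.2))
      ((continuous_projIcc.measurable.comp
        (measurable_real_toNNReal.comp measurable_fst)).prodMk measurable_snd)
  have h2 : ∀ ω, ∫⁻ s in Set.Icc 0 t, f s ω ∂timeMeasure =
      ∫⁻ x in Set.Ioc (0 : ℝ) t, f (Set.projIcc 0 t zero_le x.toNNReal) ω := fun ω => by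
    rw [lintegral_Icc_timeMeasure]
    refine setLIntegral_congr_fun measurableSet_Ioc fun x hx => ?_
    have hmem : x.toNNReal ∈ Set.Icc 0 t := ⟨zero_le, Real.toNNReal_le_iff_le_coe.2 hx.2⟩
    simp only [Set.projIcc_of_mem _ hmem]
  simp_rw [h2]
  exact h1.lintegral_prod_left'

theorem aemeasurable_restrict_timeMeasure {f : ℝ≥0 → Ω → ℝ≥0∞}
    (hf : Measurable fun p : Set.Icc (0 : ℝ≥0) t × Ω => f p.1 p.2) (ω : Ω) :
    AEMeasurable (fun s => f s ω) (timeMeasure.restrict (Set.Icc 0 t)) :=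
  aemeasurable_restrict_of_measurable_subtype measurableSet_Icc (hf.comp measurable_prodMk_right)

theorem lintegral_lintegral_timeMeasure_add {f : ℝ≥0 → Ω → ℝ≥0∞}
    (hf : Measurable fun p : Set.Icc (0 : ℝ≥0) t × Ω => f p.1 p.2) (g : ℝ≥0 → Ω → ℝ≥0∞) :
    ∫⁻ ω, (∫⁻ s in Set.Icc 0 t, (f s ω + g s ω) ∂timeMeasure) ∂P =
      ∫⁻ ω, (∫⁻ s in Set.Icc 0 t, f s ω ∂timeMeasure) ∂P +
        ∫⁻ ω, (∫⁻ s in Set.Icc 0 t, g s ω ∂timeMeasure) ∂P := by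
  simp_rw [fun ω => lintegral_add_left' (aemeasurable_restrict_timeMeasure hf ω) fun s => g s ω]
  exact lintegral_add_left (measurable_setLIntegral_timeMeasure hf) _

theorem lintegral_lintegral_timeMeasure_tsum {f : ℕ → ℝ≥0 → Ω → ℝ≥0∞}
    (hf : ∀ j, Measurable fun p : Set.Icc (0 : ℝ≥0) t × Ω => f j p.1 p.2) :
    ∫⁻ ω, (∫⁻ s in Set.Icc 0 t, ∑' j, f j s ω ∂timeMeasure) ∂P =
      ∑' j, ∫⁻ ω, (∫⁻ s in Set.Icc 0 t, f j s ω ∂timeMeasure) ∂P := by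
  simp_rw [fun ω => lintegral_tsum fun j => aemeasurable_restrict_timeMeasure (hf j) ω]
  exact lintegral_tsum fun j => (measurable_setLIntegral_timeMeasure (hf j)).aemeasurable

variable {Y : Type*} [NormedAddCommGroup Y] {φ : ℝ≥0 → Ω → Y}

theorem SimpleProcess.stronglyMeasurable_eval (S : SimpleProcess ℱ P Y) :
    StronglyMeasurable fun p : Set.Icc (0 : ℝ≥0) t × Ω => S.eval p.1 p.2 := by
  have : StronglyMeasurable fun p : ℝ≥0 × Ω => S.eval p.1 p.2 := by
    refine Finset.stronglyMeasurable_fun_sum _ fun k _ => ?_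
    have h1 : StronglyMeasurable fun p : ℝ≥0 × Ω => S.coeff k p.2 :=
      ((S.measurable_coeff k).mono (ℱ.le _)).comp_measurable measurable_snd
    exact h1.indicator (s := Prod.fst ⁻¹' Set.Ioc (S.time k.castSucc) (S.time k.succ))
      (measurable_fst measurableSet_Ioc)
  exact this.comp_measurable ((measurable_subtype_coe.comp measurable_fst).prodMk measurable_snd)

variable (P t) in
/-- The squared distance `E ∫₀ᵗ ‖φ(s) - ψ(s)‖² ds`. -/
def processDistSq (φ ψ : ℝ≥0 → Ω → Y) : ℝ≥0∞ :=
  ∫⁻ ω, (∫⁻ s in Set.Icc 0 t, ‖φ s ω - ψ s ω‖ₑ ^ 2 ∂timeMeasure) ∂P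

theorem processDistSq_le {S φ : ℝ≥0 → Ω → Y} (S' : ℝ≥0 → Ω → Y)
    (hS : StronglyMeasurable fun p : Set.Icc (0 : ℝ≥0) t × Ω => S p.1 p.2)
    (hφ : StronglyMeasurable fun p : Set.Icc (0 : ℝ≥0) t × Ω => φ p.1 p.2) :
    processDistSq P t S S' ≤ 2 * (processDistSq P t S φ + processDistSq P t S' φ) := by
  have hm : Measurable fun p : Set.Icc (0 : ℝ≥0) t × Ω => ‖S p.1 p.2 - φ p.1 p.2‖ₑ ^ 2 :=
    (hS.sub hφ).enorm.pow_const 2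
  simp only [processDistSq]
  rw [← lintegral_lintegral_timeMeasure_add (f := fun s ω => ‖S s ω - φ s ω‖ₑ ^ 2) hm
    fun s ω => ‖S' s ω - φ s ω‖ₑ ^ 2, ← lintegral_const_mul' _ _ (by norm_num)]
  refine lintegral_mono fun ω => ?_
  rw [← lintegral_const_mul' _ _ (by norm_num)]
  refine lintegral_mono fun s => ?_
  simpa using enorm_sub_sq_le (S s ω - φ s ω) (S' s ω - φ s ω)

theorem cauchySeq_of_edist_sq_le {E : Type*} [PseudoEMetricSpace E] {z : ℕ → E} {e : ℕ → ℝ≥0∞}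
    (he : Tendsto e atTop (𝓝 0)) (h : ∀ m n, edist (z m) (z n) ^ 2 ≤ 2 * (e m + e n)) :
    CauchySeq z := by
  rw [EMetric.cauchySeq_iff]
  intro ε hε
  have h4 : (0 : ℝ≥0∞) < ε ^ 2 / 4 := ENNReal.div_pos (pow_ne_zero 2 hε.ne') (by norm_num)
  obtain ⟨N, hN⟩ := eventually_atTop.1 (he.eventually (gt_mem_nhds h4))
  refine ⟨N, fun m hm n hn => lt_of_not_ge fun hle => ?_⟩
  refine absurd (pow_le_pow_left' hle 2) (not_le.2 ((h m n).trans_lt ?_))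
  calc 2 * (e m + e n) < 2 * (ε ^ 2 / 4 + ε ^ 2 / 4) := by
        refine ENNReal.mul_lt_mul_right (by norm_num) (by norm_num) ?_
        exact ENNReal.add_lt_add (hN m hm) (hN n hn)
    _ = 4 * (ε ^ 2 / 4) := by ring
    _ = ε ^ 2 := ENNReal.mul_div_cancel (by norm_num) (by norm_num)

theorem edist_toLp_sq {f g : Ω → Y} (hf : MemLp f 2 P) (hg : MemLp g 2 P) :
    edist (hf.toLp f) (hg.toLp g) ^ 2 = ∫⁻ ω, ‖f ω - g ω‖ₑ ^ 2 ∂P := by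
  rw [Lp.edist_toLp_toLp, eLpNorm_two_sq]
  rfl

theorem tendsto_toLp_iff {f : ℕ → Ω → Y} {g : Ω → Y} (hf : ∀ n, MemLp (f n) 2 P)
    (hg : MemLp g 2 P) : Tendsto (fun n => (hf n).toLp (f n)) atTop (𝓝 (hg.toLp g)) ↔
      Tendsto (fun n => eLpNorm (fun ω => f n ω - g ω) 2 P) atTop (𝓝 0) :=
  Lp.tendsto_Lp_iff_tendsto_eLpNorm'' f hf g hg

variable [InnerProductSpace ℝ Y]

theorem inner_toLp {f g : Ω → Y} (hf : MemLp f 2 P) (hg : MemLp g 2 P) :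
    ⟪hf.toLp f, hg.toLp g⟫_ℝ = ∫ ω, ⟪f ω, g ω⟫_ℝ ∂P := by
  rw [L2.inner_def]
  refine integral_congr_ae ?_
  filter_upwards [hf.coeFn_toLp, hg.coeFn_toLp] with ω h1 h2
  rw [h1, h2]

variable [IsProbabilityMeasure P]

/-- The isometry followed by the squared triangle inequality through `φ`. Existence, uniqueness and
the `L²` bound all follow from this estimate. -/
theorem edist_toLp_integral_sq_le (S S' : SimpleProcess ℱ P Y) (h : IsWiener ℱ P β)
    (hφ : StronglyMeasurable fun p : Set.Icc (0 : ℝ≥0) t × Ω => φ p.1 p.2) :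
    edist ((S.memLp_integral h t).toLp _) ((S'.memLp_integral h t).toLp _) ^ 2 ≤
      2 * (processDistSq P t S.eval φ + processDistSq P t S'.eval φ) := by
  rw [edist_toLp_sq, S.lintegral_integral_sub_sq S' h]
  exact processDistSq_le S'.eval S.stronglyMeasurable_eval hφ

theorem exists_isItoIntegral [CompleteSpace Y] (h : IsWiener ℱ P β)
    (hφ : IsItoIntegrand ℱ P φ t) : ∃ Z, IsItoIntegral ℱ P β φ t Z := by
  have hex : ∀ n : ℕ, ∃ S : SimpleProcess ℱ P Y,
      processDistSq P t S.eval φ ≤ ((n : ℝ≥0∞) + 1)⁻¹ := fun n =>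
    exists_simpleProcess_le hφ.measurable hφ.adapted hφ.sq_integrable (by simp)
  choose S hS using hex
  have h0 : Tendsto (fun n => processDistSq P t (S n).eval φ) atTop (𝓝 0) := by
    refine tendsto_of_tendsto_of_tendsto_of_le_of_le tendsto_const_nhds ?_ (fun _ => zero_le) hS
    have := (tendsto_add_atTop_iff_nat 1).2 ENNReal.tendsto_inv_nat_nhds_zero
    simpa using this
  obtain ⟨z, hz⟩ := cauchySeq_tendsto_of_complete (cauchySeq_of_edist_sq_le h0 fun m n =>
    edist_toLp_integral_sq_le (S m) (S n) h hφ.measurable)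
  refine ⟨z, Lp.memLp z, S, h0, ?_⟩
  rw [← tendsto_toLp_iff (fun n => (S n).memLp_integral h t) (Lp.memLp z), Lp.toLp_coeFn]
  exact hz

theorem IsItoIntegral.ae_eq (h : IsWiener ℱ P β)
    (hφ : StronglyMeasurable fun p : Set.Icc (0 : ℝ≥0) t × Ω => φ p.1 p.2) {Z Z' : Ω → Y}
    (hZ : IsItoIntegral ℱ P β φ t Z) (hZ' : IsItoIntegral ℱ P β φ t Z') : Z' =ᵐ[P] Z := by
  obtain ⟨hL, S, hS, hlim⟩ := hZ
  obtain ⟨hL', S', hS', hlim'⟩ := hZ'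
  rw [← tendsto_toLp_iff (fun n => (S n).memLp_integral h t) hL] at hlim
  rw [← tendsto_toLp_iff (fun n => (S' n).memLp_integral h t) hL'] at hlim'
  have h1 := ENNReal.Tendsto.pow (n := 2) (hlim'.edist hlim)
  have h2 : Tendsto (fun n => 2 * (processDistSq P t (S' n).eval φ +
      processDistSq P t (S n).eval φ)) atTop (𝓝 0) := by
    have := ENNReal.Tendsto.const_mul (a := 2) (hS'.add hS) (Or.inr (by norm_num))
    rwa [add_zero, mul_zero] at this
  have h3 := le_of_tendsto_of_tendsto' h1 h2 fun n => edist_toLp_integral_sq_le (S' n) (S n) h hφ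
  have h4 : edist (hL'.toLp Z') (hL.toLp Z) = 0 := by simpa using h3
  exact (MemLp.toLp_eq_toLp_iff hL' hL).1 (edist_eq_zero.1 h4)

/-- Comparison of the approximants with the zero process. The constant `2` is not sharp, but
suffices for summability. -/
theorem IsItoIntegral.lintegral_sq_le (h : IsWiener ℱ P β)
    (hφ : StronglyMeasurable fun p : Set.Icc (0 : ℝ≥0) t × Ω => φ p.1 p.2) {Z : Ω → Y}
    (hZ : IsItoIntegral ℱ P β φ t Z) : ∫⁻ ω, ‖Z ω‖ₑ ^ 2 ∂P ≤
      2 * ∫⁻ ω, (∫⁻ s in Set.Icc 0 t, ‖φ s ω‖ₑ ^ 2 ∂timeMeasure) ∂P := by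
  obtain ⟨hL, S, hS, hlim⟩ := hZ
  rw [← tendsto_toLp_iff (fun n => (S n).memLp_integral h t) hL] at hlim
  have h1 := ENNReal.Tendsto.pow (n := 2) (hlim.edist (tendsto_const_nhds
    (x := ((SimpleProcess.zero ℱ P Y).memLp_integral h t).toLp _)))
  have h2 : Tendsto (fun n => 2 * (processDistSq P t (S n).eval φ +
      processDistSq P t (SimpleProcess.zero ℱ P Y).eval φ)) atTop
      (𝓝 (2 * (0 + processDistSq P t (SimpleProcess.zero ℱ P Y).eval φ))) :=
    ENNReal.Tendsto.const_mul (hS.add tendsto_const_nhds) (Or.inr (by norm_num))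
  have h3 := le_of_tendsto_of_tendsto' h1 h2 fun n => edist_toLp_integral_sq_le (S n) _ h hφ
  rw [edist_toLp_sq] at h3
  simpa [processDistSq, SimpleProcess.zero, SimpleProcess.integral, SimpleProcess.eval] using h3

/-- Orthogonality holds for simple processes, and the inner product of `L²` is continuous. -/
theorem IsItoIntegral.inner_eq_zero (h : IsWiener ℱ P β) (h' : IsWiener ℱ P β')
    (hc : HasCovariation P ℱ β β' 0) {φ' : ℝ≥0 → Ω → Y} {Z Z' : Ω → Y}
    (hZ : IsItoIntegral ℱ P β φ t Z) (hZ' : IsItoIntegral ℱ P β' φ' t Z') :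
    ⟪hZ.1.toLp Z, hZ'.1.toLp Z'⟫_ℝ = 0 := by
  obtain ⟨hL, S, hS, hlim⟩ := hZ
  obtain ⟨hL', S', hS', hlim'⟩ := hZ'
  rw [← tendsto_toLp_iff (fun n => (S n).memLp_integral h t) hL] at hlim
  rw [← tendsto_toLp_iff (fun n => (S' n).memLp_integral h' t) hL'] at hlim'
  refine tendsto_nhds_unique (hlim.inner hlim') ?_
  simp_rw [inner_toLp, fun n => (S n).integral_inner_eq_zero (S' n) h h' hc t]
  exact tendsto_const_nhds

theorem cauchySeq_sum_of_orthogonal {E : Type*} [NormedAddCommGroup E] [InnerProductSpace ℝ E]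
    [CompleteSpace E] {x : ℕ → E} (horth : Pairwise fun i j => ⟪x i, x j⟫_ℝ = 0)
    (hsum : Summable fun j => ‖x j‖ ^ 2) : CauchySeq fun m => ∑ j ∈ Finset.range m, x j := by
  have hV : OrthogonalFamily ℝ (fun j => ↥(ℝ ∙ x j)) fun j => (ℝ ∙ x j).subtypeₗᵢ :=
    OrthogonalFamily.of_pairwise fun i j hij => by
      rw [Function.onFun, Submodule.isOrtho_span]
      rintro _ rfl _ rfl
      exact horth hij
  have := (hV.summable_iff_norm_sq_summable
    fun j => ⟨x j, Submodule.mem_span_singleton_self (x j)⟩).2 hsum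
  exact this.hasSum.tendsto_sum_nat.cauchySeq

end ItoIntegral

/-! ### The integral with respect to a cylindrical Wiener process -/

section CylindricalIntegral

variable {Ω : Type*} {mΩ : MeasurableSpace Ω} {P : Measure Ω} {ℱ : Filtration ℝ≥0 mΩ}
  {Y : Type*} [NormedAddCommGroup Y] [InnerProductSpace ℝ Y] [CompleteSpace Y]
  {H : Type*} [NormedAddCommGroup H] [InnerProductSpace ℝ H] [CompleteSpace H]
  {T t : ℝ≥0} {Φ : ℝ≥0 → Ω → H →L[ℝ] Y}

omit [InnerProductSpace ℝ Y] [CompleteSpace Y] in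
theorem memLp_partialSum {X : ℕ → Ω → Y} (hX : ∀ j, MemLp (X j) 2 P) (m : ℕ) :
    MemLp (partialSum X m) 2 P :=
  memLp_finsetSum _ fun j _ => hX j

omit [InnerProductSpace ℝ Y] [CompleteSpace Y] in
theorem toLp_partialSum {X : ℕ → Ω → Y} (hX : ∀ j, MemLp (X j) 2 P) (m : ℕ) :
    (memLp_partialSum hX m).toLp (partialSum X m) =
      ∑ j ∈ Finset.range m, (hX j).toLp (X j) := by
  induction m with
  | zero =>
    rw [Finset.sum_range_zero, ← MemLp.toLp_zero (p := 2) (μ := P) (E := Y) MemLp.zero,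
      MemLp.toLp_eq_toLp_iff]
    exact Eventually.of_forall fun ω => by simp [partialSum]
  | succ m ih =>
    rw [Finset.sum_range_succ, ← ih, ← MemLp.toLp_add]
    refine MemLp.toLp_congr _ _ (Eventually.of_forall fun ω => ?_)
    exact Finset.sum_range_succ _ _

/-- Partial sums of orthogonal random variables with summable squares are a Cauchy sequence. -/
theorem cauchySeq_partialSum {X : ℕ → Ω → Y} (hX : ∀ j, MemLp (X j) 2 P)
    (horth : Pairwise fun i j => ⟪(hX i).toLp (X i), (hX j).toLp (X j)⟫_ℝ = 0)
    (hsum : ∑' j, ∫⁻ ω, ‖X j ω‖ₑ ^ 2 ∂P ≠ ∞) :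
    CauchySeq fun m => (memLp_partialSum hX m).toLp (partialSum X m) := by
  simp_rw [toLp_partialSum hX]
  refine cauchySeq_sum_of_orthogonal horth ?_
  have h : ∀ j, ‖(hX j).toLp (X j)‖ ^ 2 = (∫⁻ ω, ‖X j ω‖ₑ ^ 2 ∂P).toReal := fun j => by
    rw [Lp.norm_toLp, ← ENNReal.toReal_pow, eLpNorm_two_sq]
  simp_rw [h]
  exact ENNReal.summable_toReal hsum

theorem IsIntegrand.sum_lt_top (hΦ : IsIntegrand ℱ P T Φ) (g : HilbertBasis ℕ ℝ H) (ht : t ≤ T) :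
    ∑' j, ∫⁻ ω, (∫⁻ s in Set.Icc 0 t, ‖Φ s ω (g j)‖ₑ ^ 2 ∂timeMeasure) ∂P < ∞ := by
  refine lt_of_le_of_lt ?_ hΦ.sq_integrable
  simp_rw [hsNormSq_eq_tsum g]
  rw [lintegral_lintegral_timeMeasure_tsum (f := fun j s ω => ‖Φ s ω (g j)‖ₑ ^ 2) fun j =>
    (hΦ.measurable (g j)).enorm.pow_const 2]
  refine ENNReal.tsum_le_tsum fun j => lintegral_mono fun ω => ?_
  exact lintegral_mono_set (Set.Icc_subset_Icc_right ht)

theorem IsIntegrand.isItoIntegrand (hΦ : IsIntegrand ℱ P T Φ) (g : HilbertBasis ℕ ℝ H)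
    (ht : t ≤ T) (j : ℕ) : IsItoIntegrand ℱ P (fun s ω => Φ s ω (g j)) t where
  measurable := (hΦ.measurable (g j)).comp_measurable
    (g := fun p : Set.Icc (0 : ℝ≥0) t × Ω => (Set.inclusion (Set.Icc_subset_Icc_right ht) p.1, p.2))
    (((measurable_inclusion (Set.Icc_subset_Icc_right ht)).comp measurable_fst).prodMk
      measurable_snd)
  adapted s hs := hΦ.adapted (g j) s (hs.trans ht)
  sq_integrable := (ENNReal.le_tsum j).trans_lt (hΦ.sum_lt_top g ht)

variable {g : HilbertBasis ℕ ℝ H} {β : ℕ → ℝ≥0 → Ω → ℝ} [IsProbabilityMeasure P]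

theorem AreTermIntegrals.cauchySeq (hβ : ∀ j, IsWiener ℱ P (β j))
    (hβ_indep : iIndepFun (fun j ω t => β j t ω) P) (hΦ : IsIntegrand ℱ P T Φ) (ht : t ≤ T)
    {X : ℕ → Ω → Y} (hX : AreTermIntegrals ℱ P g β Φ t X) :
    CauchySeq fun m => (memLp_partialSum (fun j => (hX j).1) m).toLp (partialSum X m) := by
  refine cauchySeq_partialSum (fun j => (hX j).1) (fun i j hij => ?_) ?_
  · exact (hX i).inner_eq_zero (hβ i) (hβ j)
      ((hβ i).hasCovariation_zero (hβ j) (hβ_indep.indepFun hij)) (hX j)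
  · refine ne_top_of_le_ne_top (ENNReal.mul_ne_top (a := 2) (by norm_num)
      (hΦ.sum_lt_top g ht).ne) ?_
    rw [← ENNReal.tsum_mul_left]
    exact ENNReal.tsum_le_tsum fun j =>
      (hX j).lintegral_sq_le (hβ j) (hΦ.isItoIntegrand g ht j).measurable

theorem exists_areTermIntegrals (hβ : ∀ j, IsWiener ℱ P (β j)) (hΦ : IsIntegrand ℱ P T Φ)
    (ht : t ≤ T) : ∃ X, AreTermIntegrals ℱ P g β Φ t X := by
  choose X hX using fun j => exists_isItoIntegral (hβ j) (hΦ.isItoIntegrand g ht j)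
  exact ⟨X, hX⟩

theorem exists_isCylindricalIntegral (hβ : ∀ j, IsWiener ℱ P (β j))
    (hβ_indep : iIndepFun (fun j ω t => β j t ω) P) (hΦ : IsIntegrand ℱ P T Φ) (ht : t ≤ T) :
    ∃ I, IsCylindricalIntegral ℱ P g β Φ t I := by
  obtain ⟨X, hX⟩ := exists_areTermIntegrals (g := g) hβ hΦ ht
  obtain ⟨z, hz⟩ := cauchySeq_tendsto_of_complete (hX.cauchySeq hβ hβ_indep hΦ ht)
  refine ⟨z, Lp.memLp z, X, hX, ?_⟩
  rw [← tendsto_toLp_iff (memLp_partialSum fun j => (hX j).1) (Lp.memLp z), Lp.toLp_coeFn]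
  exact hz

/-- The two integrals may use different versions of the terms. These agree almost surely, so the
partial sums coincide as elements of `L²`. -/
theorem IsCylindricalIntegral.ae_eq (hβ : ∀ j, IsWiener ℱ P (β j)) (hΦ : IsIntegrand ℱ P T Φ)
    (ht : t ≤ T) {I I' : Ω → Y} (hI : IsCylindricalIntegral ℱ P g β Φ t I)
    (hI' : IsCylindricalIntegral ℱ P g β Φ t I') : I' =ᵐ[P] I := by
  obtain ⟨hL, X, hX, hlim⟩ := hI
  obtain ⟨hL', X', hX', hlim'⟩ := hI'
  rw [← tendsto_toLp_iff (memLp_partialSum fun j => (hX j).1) hL] at hlim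
  rw [← tendsto_toLp_iff (memLp_partialSum fun j => (hX' j).1) hL'] at hlim'
  rw [← MemLp.toLp_eq_toLp_iff hL' hL]
  refine tendsto_nhds_unique hlim' (hlim.congr fun m => ?_)
  rw [toLp_partialSum fun j => (hX j).1, toLp_partialSum fun j => (hX' j).1]
  refine Finset.sum_congr rfl fun j _ => ?_
  rw [MemLp.toLp_eq_toLp_iff]
  exact (hX' j).ae_eq (hβ j) (hΦ.isItoIntegrand g ht j).measurable (hX j)

end CylindricalIntegral

/-! ### The cylindrical Wiener process in an auxiliary space -/

section CylindricalProcess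

variable {Ω : Type*} {mΩ : MeasurableSpace Ω} {P : Measure Ω} {ℱ : Filtration ℝ≥0 mΩ}
  {K : Type*} [NormedAddCommGroup K] [InnerProductSpace ℝ K] [CompleteSpace K]
  {H : Type*} [NormedAddCommGroup H] [InnerProductSpace ℝ H] [CompleteSpace H]
  {g : HilbertBasis ℕ ℝ H} {β : ℕ → ℝ≥0 → Ω → ℝ} {A : H →L[ℝ] K}

theorem IsWiener.memLp_eval {β : ℝ≥0 → Ω → ℝ} (h : IsWiener ℱ P β) (t : ℝ≥0) : MemLp (β t) 2 P :=
  (h.isBrownian.toIsPreBrownianReal.hasLaw_eval t).hasGaussianLaw.memLp_two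

omit [CompleteSpace K] in
theorem IsWiener.memLp_eval_smul {β : ℝ≥0 → Ω → ℝ} (h : IsWiener ℱ P β) (t : ℝ≥0) (x : K) :
    MemLp (fun ω => β t ω • x) 2 P :=
  (ContinuousLinearMap.toSpanSingleton ℝ x).comp_memLp' (h.memLp_eval t)

theorem integral_eval_mul_eval (hβ : ∀ j, IsWiener ℱ P (β j))
    (hβ_indep : iIndepFun (fun j ω t => β j t ω) P) (t : ℝ≥0) (i j : ℕ) :
    ∫ ω, β i t ω * β j t ω ∂P = if i = j then (t : ℝ) else 0 := by
  have hB : ∀ j, IsPreBrownianReal (β j) P := fun j => (hβ j).isBrownian.toIsPreBrownianReal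
  split_ifs with hij
  · subst hij
    have h1 := ((hB i).hasLaw_eval t).variance_eq
    rw [variance_id_gaussianReal, variance_of_integral_eq_zero ((hB i).aemeasurable t)
      ((hB i).integral_eval t)] at h1
    simpa only [sq] using h1
  · have hp : Measurable fun x : ℝ≥0 → ℝ => x t := measurable_pi_apply t
    have := ((hβ_indep.indepFun hij).comp hp hp).integral_fun_mul_eq_mul_integral
      ((hβ i).memLp_eval t).1 ((hβ j).memLp_eval t).1
    refine this.trans (mul_eq_zero_of_left ?_ _)
    exact (hB i).integral_eval t

/-- The terms are orthogonal with squared norms `t ‖A gⱼ‖²`, whose sum is `t` times the squared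
Hilbert-Schmidt norm of `A`. -/
theorem exists_isCylindricalWiener [IsProbabilityMeasure P] (hβ : ∀ j, IsWiener ℱ P (β j))
    (hβ_indep : iIndepFun (fun j ω t => β j t ω) P) (hA : IsHilbertSchmidt A) :
    ∃ W, IsCylindricalWiener P A g β W := by
  have hL : ∀ t j, MemLp (fun ω => β j t ω • A (g j)) 2 P := fun t j =>
    (hβ j).memLp_eval_smul t _
  have hc : ∀ t, CauchySeq fun m => (memLp_partialSum (hL t) m).toLp
      (partialSum (fun j ω => β j t ω • A (g j)) m) := by
    intro t
    refine cauchySeq_partialSum (hL t) (fun i j hij => ?_) ?_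
    · beta_reduce
      rw [inner_toLp]
      simp_rw [inner_smul_left, inner_smul_right, RCLike.conj_to_real, ← mul_assoc]
      rw [integral_mul_const, integral_eval_mul_eval hβ hβ_indep, if_neg hij, zero_mul]
    · have h1 : ∀ j, ∫⁻ ω, ‖β j t ω • A (g j)‖ₑ ^ 2 ∂P = t * ‖A (g j)‖ₑ ^ 2 := by
        intro j
        simp_rw [enorm_smul, mul_pow]
        rw [lintegral_mul_const' _ _ (by simp), lintegral_enorm_sq_eq_ofReal
          ((memLp_two_iff_integrable_sq_norm ((hβ j).memLp_eval t).1).1 ((hβ j).memLp_eval t))]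
        have := integral_eval_mul_eval hβ hβ_indep t j j
        rw [if_pos rfl] at this
        simp_rw [Real.norm_eq_abs, sq_abs, sq, this, ENNReal.ofReal_coe_nnreal]
      simp_rw [h1]
      rw [ENNReal.tsum_mul_left, ← hsNormSq_eq_tsum]
      exact ENNReal.mul_ne_top (by simp) hA.ne
  choose z hz using fun t => cauchySeq_tendsto_of_complete (hc t)
  refine ⟨fun t => z t, fun t => ⟨Lp.memLp (z t), ?_⟩⟩
  have := hz t
  rw [← Lp.toLp_coeFn (z t) (Lp.memLp (z t)), tendsto_toLp_iff] at this
  exact this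

omit [InnerProductSpace ℝ K] [CompleteSpace K] in
-- `K` need not be separable, so strong measurability of the identity is not automatic. The law of
-- `W` is carried by the closure of a separable set.
theorem memLp_id_map [MeasurableSpace K] [BorelSpace K] {W : Ω → K} (hW : MemLp W 2 P) :
    MemLp id 2 (P.map W) := by
  have hm : AEMeasurable W P := hW.1.aemeasurable
  have hid : AEStronglyMeasurable id (P.map W) := by
    obtain ⟨S, hS, hWS⟩ := (aestronglyMeasurable_iff_aemeasurable_separable.1 hW.1).2
    refine aestronglyMeasurable_iff_aemeasurable_separable.2
      ⟨aemeasurable_id, closure S, hS.closure, ?_⟩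
    simp only [id_eq]
    refine (ae_map_iff hm isClosed_closure.measurableSet).2 ?_
    filter_upwards [hWS] with ω hω using subset_closure hω
  rw [memLp_map_measure_iff hid hm]
  exact hW

omit [CompleteSpace K] in
theorem tendsto_integral_inner_mul_inner {f : ℕ → Ω → K} {W : Ω → K} (hf : ∀ n, MemLp (f n) 2 P)
    (hW : MemLp W 2 P) (hlim : Tendsto (fun n => eLpNorm (fun ω => f n ω - W ω) 2 P) atTop (𝓝 0))
    (x y : K) : Tendsto (fun n => ∫ ω, ⟪x, f n ω⟫_ℝ * ⟪y, f n ω⟫_ℝ ∂P) atTop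
      (𝓝 (∫ ω, ⟪x, W ω⟫_ℝ * ⟪y, W ω⟫_ℝ ∂P)) := by
  have h : ∀ x : K, Tendsto (fun n => ((hf n).const_inner (𝕜 := ℝ) x).toLp _) atTop
      (𝓝 ((hW.const_inner (𝕜 := ℝ) x).toLp _)) := by
    intro x
    rw [tendsto_toLp_iff]
    have h0 : Tendsto (fun n => ‖x‖ₑ * eLpNorm (fun ω => f n ω - W ω) 2 P) atTop (𝓝 0) := by
      have := ENNReal.Tendsto.const_mul (a := ‖x‖ₑ) hlim (Or.inr (by simp))
      rwa [mul_zero] at this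
    refine tendsto_of_tendsto_of_tendsto_of_le_of_le tendsto_const_nhds h0 (fun _ => zero_le)
      fun n => ?_
    refine eLpNorm_le_nnreal_smul_eLpNorm_of_ae_le_mul (c := ‖x‖₊)
      (Eventually.of_forall fun ω => ?_) 2
    rw [← inner_sub_right]
    exact nnnorm_inner_le_nnnorm x (f n ω - W ω)
  have := (h y).inner (𝕜 := ℝ) (h x)
  simp_rw [inner_toLp] at this
  exact this

/-- The covariance operator of `W_c(1)` is `A A*`. -/
theorem covarianceOperator_eq [IsProbabilityMeasure P] [MeasurableSpace K] [BorelSpace K]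
    (hβ : ∀ j, IsWiener ℱ P (β j)) (hβ_indep : iIndepFun (fun j ω t => β j t ω) P)
    {W : ℝ≥0 → Ω → K} (hW : IsCylindricalWiener P A g β W) :
    covarianceOperator (P.map (W 1)) = A ∘L A.adjoint := by
  obtain ⟨hL, hlim⟩ := hW 1
  have hm : AEMeasurable (W 1) P := hL.1.aemeasurable
  ext x
  refine ext_inner_right ℝ fun y => ?_
  rw [covarianceOperator_inner (memLp_id_map hL), integral_map hm
    (Continuous.aestronglyMeasurable (by fun_prop))]
  have hf : ∀ m, MemLp (fun ω => ∑ j ∈ Finset.range m, β j 1 ω • A (g j)) 2 P := fun m =>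
    memLp_finsetSum _ fun j _ => (hβ j).memLp_eval_smul 1 _
  refine tendsto_nhds_unique (tendsto_integral_inner_mul_inner hf hL hlim x y) ?_
  have hval : ∀ m, ∫ ω, ⟪x, ∑ j ∈ Finset.range m, β j 1 ω • A (g j)⟫_ℝ *
      ⟪y, ∑ j ∈ Finset.range m, β j 1 ω • A (g j)⟫_ℝ ∂P =
      ∑ j ∈ Finset.range m, ⟪A.adjoint x, g j⟫_ℝ * ⟪g j, A.adjoint y⟫_ℝ := by
    intro m
    have hint : ∀ i j, Integrable (fun ω => β i 1 ω * β j 1 ω *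
        (⟪x, A (g i)⟫_ℝ * ⟪y, A (g j)⟫_ℝ)) P := fun i j =>
      (((hβ i).memLp_eval 1).integrable_mul ((hβ j).memLp_eval 1)).mul_const _
    have hexp : ∀ ω, ⟪x, ∑ j ∈ Finset.range m, β j 1 ω • A (g j)⟫_ℝ *
      ⟪y, ∑ j ∈ Finset.range m, β j 1 ω • A (g j)⟫_ℝ =
      ∑ i ∈ Finset.range m, ∑ j ∈ Finset.range m, β i 1 ω * β j 1 ω *
        (⟪x, A (g i)⟫_ℝ * ⟪y, A (g j)⟫_ℝ) := by
      intro ω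
      simp_rw [inner_sum, inner_smul_right, Finset.sum_mul_sum]
      refine Finset.sum_congr rfl fun i _ => Finset.sum_congr rfl fun j _ => ?_
      ring
    simp_rw [hexp]
    rw [integral_finsetSum _ fun i _ => integrable_finsetSum _ fun j _ => hint i j]
    refine Finset.sum_congr rfl fun i hi => ?_
    rw [integral_finsetSum _ fun j _ => hint i j]
    simp_rw [integral_mul_const, integral_eval_mul_eval hβ hβ_indep, ite_mul, zero_mul]
    rw [Finset.sum_ite_eq, if_pos hi, NNReal.coe_one, one_mul,
      ContinuousLinearMap.adjoint_inner_left, ContinuousLinearMap.adjoint_inner_right,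
      real_inner_comm y]
  simp_rw [hval]
  -- Parseval's identity for `A* x` and `A* y` in the basis `g`.
  have := (g.hasSum_inner_mul_inner (A.adjoint x) (A.adjoint y)).tendsto_sum_nat
  rwa [ContinuousLinearMap.adjoint_inner_right] at this

end CylindricalProcess

/-! ### Transport of integrands along an isometry -/

section Transfer

variable {Ω : Type*} {mΩ : MeasurableSpace Ω} {P : Measure Ω} {ℱ : Filtration ℝ≥0 mΩ}
  {Y : Type*} [NormedAddCommGroup Y] [InnerProductSpace ℝ Y] [CompleteSpace Y]
  {H K : Type*} [NormedAddCommGroup H] [InnerProductSpace ℝ H] [CompleteSpace H]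
  [NormedAddCommGroup K] [InnerProductSpace ℝ K] [CompleteSpace K]

/-- An isometry carries a basis to a basis, and the Hilbert-Schmidt norm does not depend on the
basis. -/
theorem hsNormSq_comp_isometry (e : K ≃ₗᵢ[ℝ] H) (S : H →L[ℝ] Y) :
    hsNormSq (S ∘L (e.toContinuousLinearEquiv : K →L[ℝ] H)) = hsNormSq S := by
  obtain ⟨w, b, -⟩ := exists_hilbertBasis ℝ K
  rw [hsNormSq_eq_tsum b, hsNormSq_eq_tsum (HilbertBasis.ofRepr (e.symm.trans b.repr))]
  rfl

theorem IsIntegrand.comp_isometry {T : ℝ≥0} {Φ : ℝ≥0 → Ω → H →L[ℝ] Y}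
    (hΦ : IsIntegrand ℱ P T Φ) (e : K ≃ₗᵢ[ℝ] H) :
    IsIntegrand ℱ P T fun s ω => Φ s ω ∘L (e.toContinuousLinearEquiv : K →L[ℝ] H) where
  isHilbertSchmidt t ht ω := by
    rw [IsHilbertSchmidt, hsNormSq_comp_isometry]
    exact hΦ.isHilbertSchmidt t ht ω
  measurable u := hΦ.measurable (e u)
  adapted u := hΦ.adapted (e u)
  sq_integrable := by
    simp_rw [hsNormSq_comp_isometry]
    exact hΦ.sq_integrable

theorem isIntegrand_comp_isometry_iff {T : ℝ≥0} {Φ : ℝ≥0 → Ω → H →L[ℝ] Y} (e : K ≃ₗᵢ[ℝ] H) :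
    IsIntegrand ℱ P T Φ ↔
      IsIntegrand ℱ P T fun s ω => Φ s ω ∘L (e.toContinuousLinearEquiv : K →L[ℝ] H) := by
  refine ⟨fun h => h.comp_isometry e, fun h => ?_⟩
  have := h.comp_isometry e.symm
  convert this using 3
  ext u
  simp

end Transfer

theorem RootSpace.incl_injective {V : Type*} [NormedAddCommGroup V] [InnerProductSpace ℝ V]
    [CompleteSpace V] (Q : V →L[ℝ] V) : Function.Injective (RootSpace.incl Q) :=
  Subtype.val_injective

end CylindricalWiener

end

/-! ### The main theorem -/

theorem mainTheorem1
    {Ω : Type*} {mΩ : MeasurableSpace Ω} (P : Measure Ω) [IsProbabilityMeasure P]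
    (ℱ : Filtration ℝ≥0 mΩ)
    {U : Type*} [NormedAddCommGroup U] [InnerProductSpace ℝ U] [CompleteSpace U]
    {Y : Type*} [NormedAddCommGroup Y] [InnerProductSpace ℝ Y] [CompleteSpace Y]
    (Q : U →L[ℝ] U) (hQ : Q.IsPositive) (hQ_pos : ∀ x, x ≠ 0 → Q x ≠ 0)
    (g : HilbertBasis ℕ ℝ (RootSpace Q))
    (β : ℕ → ℝ≥0 → Ω → ℝ) (hβ : ∀ j, IsWiener ℱ P (β j))
    (hβ_indep : iIndepFun (fun j ω t => β j t ω) P)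
    (T : ℝ≥0) :
    -- the integral of every integrand is well defined
    (∀ Φ : ℝ≥0 → Ω → RootSpace Q →L[ℝ] Y, IsIntegrand ℱ P T Φ → ∀ t ≤ T,
      (∀ j, ∃ Z, IsItoIntegral ℱ P (β j) (fun s ω => Φ s ω (g j)) t Z ∧
        ∀ Z', IsItoIntegral ℱ P (β j) (fun s ω => Φ s ω (g j)) t Z' → Z' =ᵐ[P] Z) ∧
      (∀ X, AreTermIntegrals ℱ P g β Φ t X →
        ∃ h : ∀ m, MemLp (partialSum X m) 2 P, CauchySeq fun m => (h m).toLp (partialSum X m)) ∧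
      (∃ I, IsCylindricalIntegral ℱ P g β Φ t I ∧
        ∀ I', IsCylindricalIntegral ℱ P g β Φ t I' → I' =ᵐ[P] I)) ∧
    -- neither the class of integrands nor the integral depends on the auxiliary space
    (∀ (U₁ : Type*) [NormedAddCommGroup U₁] [InnerProductSpace ℝ U₁] [CompleteSpace U₁]
      [MeasurableSpace U₁] [BorelSpace U₁] (J : U →L[ℝ] U₁),
      Function.Injective J → IsHilbertSchmidt (J ∘L RootSpace.incl Q) →
      (∃ W, IsCylindricalWiener P (J ∘L RootSpace.incl Q) g β W) ∧
      ∀ W, IsCylindricalWiener P (J ∘L RootSpace.incl Q) g β W →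
        ∃ e : RootSpace Q ≃ₗᵢ[ℝ] RootSpace (covarianceOperator (P.map (W 1))),
          (∀ u, RootSpace.incl _ (e u) = J (RootSpace.incl Q u)) ∧
          ∀ Φ : ℝ≥0 → Ω → RootSpace Q →L[ℝ] Y,
            (IsIntegrand ℱ P T Φ ↔
              IsIntegrand ℱ P T fun s ω => Φ s ω ∘L (e.symm.toContinuousLinearEquiv :
                RootSpace (covarianceOperator (P.map (W 1))) →L[ℝ] RootSpace Q)) ∧
            ∀ t ≤ T, ∀ I, IsCylindricalIntegral ℱ P g β Φ t I ↔
              IsCylindricalIntegral ℱ P (fun j => e (g j)) β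
                (fun s ω => Φ s ω ∘L (e.symm.toContinuousLinearEquiv :
                  RootSpace (covarianceOperator (P.map (W 1))) →L[ℝ] RootSpace Q)) t I) := by
  refine ⟨fun Φ hΦ t ht => ⟨fun j => ?_, fun X hX => ?_, ?_⟩, ?_⟩
  · obtain ⟨Z, hZ⟩ := exists_isItoIntegral (hβ j) (hΦ.isItoIntegrand g ht j)
    exact ⟨Z, hZ, fun Z' hZ' => hZ.ae_eq (hβ j) (hΦ.isItoIntegrand g ht j).measurable hZ'⟩
  · exact ⟨_, hX.cauchySeq hβ hβ_indep hΦ ht⟩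
  · obtain ⟨I, hI⟩ := exists_isCylindricalIntegral (g := g) hβ hβ_indep hΦ ht
    exact ⟨I, hI, fun I' hI' => hI.ae_eq hβ hΦ ht hI'⟩
  · intro U₁ _ _ _ _ _ J hJ hHS
    refine ⟨exists_isCylindricalWiener hβ hβ_indep hHS, fun W hW => ?_⟩
    obtain ⟨e, he⟩ := exists_isometry_rootSpace (A := J ∘L RootSpace.incl Q)
      (hJ.comp (RootSpace.incl_injective Q)) (covarianceOperator_eq hβ hβ_indep hW)
    refine ⟨e, he, fun Φ => ⟨isIntegrand_comp_isometry_iff e.symm, fun t _ I => ?_⟩⟩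
    -- Since `e.symm (e (g j)) = g j`, the two families of scalar-driven integrands are equal, and
    -- so are the two notions of integral.
    simp [IsCylindricalIntegral, AreTermIntegrals]
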